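/- **Setting.** Let $n\ge 1$, $K\ge 1$, $L>0$, $\sigma\ge 0$, $0<p\le 1$. Client $i\in\{1,\dots,n\}$ holds a distribution $\mathcal D_i$ and a loss $F_i(x;\xi)$, $x\in\mathbb R^d$; put $f_i(x)=\mathbb E_{\xi\sim\mathcal D_i}F_i(x;\xi)$ and $f=\frac1n\sum_i f_i$. Assume that $\mathbb E_{\xi\sim\mathcal D_i}\nabla F_i(x;\xi)=\nabla f_i(x)$ and $\mathbb E_{\xi\sim\mathcal D_i}\|\nabla F_i(x;\xi)-\nabla f_i(x)\|^2\le\sigma^2$ for all $i,x$, that each $f_i$ is $L$-smooth (differentiable with $L$-Lipschitz gradient, possibly non-convex), and that $f$ is bounded below. Let $W=(w_{ij})\in\mathbb R^{n\times n}$ be entrywise non-negative, symmetric and doubly stochastic with mixing rate $p$: $\|XW-\bar X\|_F^2\le(1-p)\|X-\bar X\|_F^2$ for all $X\in\mathbb R^{d\times n}$, where all columns of $\bar X$ equal the average of the columns of $X$. **Algorithm (K-GT).** All clients start from the same model $x_i^{(0)}=x^{(0)}$, with initial corrections $c_i^{(0)}=-G_i+\frac1n\sum_jG_j$. In round $t=0,1,\dots$,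 put $x_i^{(t)+0}=x_i^{(t)}$ and, with fresh independent samples $\xi_i^{(t)+k}\sim\mathcal D_i$, $$x_i^{(t)+k+1}=x_i^{(t)+k}-\eta_c\bigl(\nabla F_i(x_i^{(t)+k};\xi_i^{(t)+k})+c_i^{(t)}\bigr),\quad 0\le k<K,\qquad z_i^{(t)}=\tfrac1{K\eta_c}\bigl(x_i^{(t)}-x_i^{(t)+K}\bigr),$$ $$c_i^{(t+1)}=c_i^{(t)}-z_i^{(t)}+\sum_jw_{ij}z_j^{(t)},\qquad x_i^{(t+1)}=\sum_jw_{ij}\bigl(x_j^{(t)}-K\eta_s\eta_cz_j^{(t)}\bigr).$$ Write $\bar x^{(t)}=\frac1n\sum_ix_i^{(t)}$ and $F_0=f(x^{(0)})-\inf f$. **Theorem 1 (K-GT convergence).** There is a universal constant $C>0$ such that for all $n,K,L,\sigma,p$ as above and every $\epsilon>0$ there are constant stepsizes $0<\eta_c\le C\frac{p}{KL}$ and $0<\eta_s\le Cp$ such that, for all $d$, $W$, $\mathcal D_i$, $F_i$, $x^{(0)}$ as above, with $$B=\Bigl(\frac{\sigma^2}{Kn\epsilon^2}+\frac{\sigma}{p^2\sqrt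 K\,\epsilon^{3/2}}+\frac1{p^2\epsilon}\Bigr)LF_0:$$ (a) if the corrections are initialized with the local gradients, $G_i=\nabla f_i(x^{(0)})$, then $$\frac1{T+1}\sum_{t=0}^T\mathbb E\|\nabla f(\bar x^{(t)})\|^2\le\epsilon\qquad(*)$$ for every number of rounds $T\ge0$ with $T+1\ge C\,B$; (b) if they are initialized with stochastic gradients, $G_i=\nabla F_i(x^{(0)};\xi_i)$ with independent samples $\xi_i\sim\mathcal D_i$, then $(*)$ holds for every $T\ge 0$ with $T+1\ge C\bigl(B+p\min\{K,\sigma^2/\epsilon\}\bigr)$. Neither bound involves any measure of the heterogeneity of the $f_i$. -/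

import Mathlib

open MeasureTheory ProbabilityTheory

noncomputable section

namespace KGT

/-- The parameter space `ℝ^d` with its Euclidean norm. -/
abbrev Vec (d : ℕ) : Type := EuclideanSpace ℝ (Fin d)

/-- The average over the clients, `(1/n) ∑ᵢ vᵢ`. -/
def mean {n d : ℕ} (v : Fin n → Vec d) : Vec d := (n : ℝ)⁻¹ • ∑ i, v i

section Problem

variable {n d : ℕ} {Ξ : Type*}

/-- The stochastic gradient `∇Fᵢ(x; s)` (gradient in `x`) of client `i` at the sample `s`. -/
def stochGrad (F : Fin n → Vec d → Ξ → ℝ) (i : Fin n) (x : Vec d) (s : Ξ) : Vec d :=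
  gradient (fun y => F i y s) x

variable [MeasurableSpace Ξ]

/-- The local objective `fᵢ(x) = E_{s ∼ 𝒟ᵢ} Fᵢ(x; s)`. -/
def localLoss (D : Fin n → Measure Ξ) (F : Fin n → Vec d → Ξ → ℝ) (i : Fin n) (x : Vec d) : ℝ :=
  ∫ s, F i x s ∂(D i)

/-- The global objective `f = (1/n) ∑ᵢ fᵢ`. -/
def globalLoss (D : Fin n → Measure Ξ) (F : Fin n → Vec d → Ξ → ℝ) (x : Vec d) : ℝ :=
  (n : ℝ)⁻¹ * ∑ i, localLoss D F i x

/-- The distributed stochastic problem: the expectations defining `fᵢ` and `∇fᵢ = E ∇Fᵢ` make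
sense, every `fᵢ` is `L`-smooth, the stochastic gradients have variance at most `σ²`, and `f` is
bounded below.  Nothing relates the different `fᵢ` to each other. -/
structure IsProblem (L σ : ℝ) (D : Fin n → Measure Ξ) (F : Fin n → Vec d → Ξ → ℝ) : Prop where
  prob : ∀ i, IsProbabilityMeasure (D i)
  integrable : ∀ i x, Integrable (F i x) (D i)
  sample_differentiable : ∀ i x, ∀ᵐ s ∂(D i), DifferentiableAt ℝ (fun y => F i y s) x
  measurable_stochGrad : ∀ i, Measurable fun q : Vec d × Ξ => stochGrad F i q.1 q.2
  unbiased : ∀ i x, ∫ s, stochGrad F i x s ∂(D i) = gradient (localLoss D F i) x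
  differentiable : ∀ i, Differentiable ℝ (localLoss D F i)
  smooth : ∀ i x y,
    ‖gradient (localLoss D F i) x - gradient (localLoss D F i) y‖ ≤ L * ‖x - y‖
  variance : ∀ i x,
    ∫⁻ s, ‖stochGrad F i x s - gradient (localLoss D F i) x‖ₑ ^ 2 ∂(D i) ≤ ENNReal.ofReal (σ ^ 2)
  bddBelow : BddBelow (Set.range (globalLoss D F))

/-- The initial gap `F₀ = f(x⁰) - inf f`. -/
def initialGap (D : Fin n → Measure Ξ) (F : Fin n → Vec d → Ξ → ℝ) (x₀ : Vec d) : ℝ :=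
  globalLoss D F x₀ - ⨅ x, globalLoss D F x

/-- The samples drawn by the algorithm: `ξinit i` in the initialization and `ξ t k i` in local
step `k` of communication round `t`; all are independent, and client `i` samples from `𝒟ᵢ`. -/
structure IsSampling {Ω : Type*} [MeasurableSpace Ω] (P : Measure Ω) (D : Fin n → Measure Ξ)
    (ξinit : Fin n → Ω → Ξ) (ξ : ℕ → ℕ → Fin n → Ω → Ξ) : Prop where
  measurable_init : ∀ i, Measurable (ξinit i)
  measurable_step : ∀ t k i, Measurable (ξ t k i)
  law_init : ∀ i, P.map (ξinit i) = D i
  law_step : ∀ t k i, P.map (ξ t k i) = D i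
  indep : iIndepFun
    (Sum.elim ξinit (fun j : ℕ × ℕ × Fin n => ξ j.1 j.2.1 j.2.2)) P

end Problem

/-- `W` is a symmetric doubly stochastic matrix with mixing rate `p` on `d × n` matrices `X`
(stored by columns): `‖XW - X̄‖_F² ≤ (1-p) ‖X - X̄‖_F²`. -/
structure IsMixing {n : ℕ} (d : ℕ) (p : ℝ) (W : Matrix (Fin n) (Fin n) ℝ) : Prop where
  nonneg : ∀ i j, 0 ≤ W i j
  symm : W.IsSymm
  row_sum : ∀ i, ∑ j, W i j = 1
  col_sum : ∀ j, ∑ i, W i j = 1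
  mixing : ∀ X : Fin n → Vec d,
    ∑ i, ‖∑ j, W j i • X j - mean X‖ ^ 2 ≤ (1 - p) * ∑ i, ‖X i - mean X‖ ^ 2

section Algorithm

variable {n d : ℕ}

/-- Local models after `k` local steps started from `x` with correction `c`; `g k i` is the
gradient oracle of client `i` in step `k`. -/
def localSteps (ηc : ℝ) (g : ℕ → Fin n → Vec d → Vec d) (x c : Fin n → Vec d) :
    ℕ → Fin n → Vec d
  | 0 => x
  | k + 1 => fun i =>
      localSteps ηc g x c k i - ηc • (g k i (localSteps ηc g x c k i) + c i)

/-- The tracking variable `zᵢ = (xᵢ - xᵢ^{+K}) / (K η_c)` of a round. -/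
def tracking (K : ℕ) (ηc : ℝ) (g : ℕ → Fin n → Vec d → Vec d) (x c : Fin n → Vec d)
    (i : Fin n) : Vec d :=
  ((K : ℝ) * ηc)⁻¹ • (x i - localSteps ηc g x c K i)

/-- The models and corrections `(x⁽ᵗ⁾, c⁽ᵗ⁾)` of K-GT after `t` communication rounds, started from
the common model `x₀` and the corrections `c₀`; `g t k i` is the gradient oracle of client `i` in
local step `k` of round `t`. -/
def iterates (K : ℕ) (ηc ηs : ℝ) (W : Matrix (Fin n) (Fin n) ℝ)
    (g : ℕ → ℕ → Fin n → Vec d → Vec d) (x₀ : Vec d) (c₀ : Fin n → Vec d) :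
    ℕ → (Fin n → Vec d) × (Fin n → Vec d)
  | 0 => (fun _ => x₀, c₀)
  | t + 1 =>
      let s := iterates K ηc ηs W g x₀ c₀ t
      let z := tracking K ηc (g t) s.1 s.2
      (fun i => ∑ j, W i j • (s.1 j - ((K : ℝ) * ηs * ηc) • z j),
       fun i => s.2 i - z i + ∑ j, W i j • z j)

/-- The initial corrections `cᵢ = -Gᵢ + (1/n) ∑ⱼ Gⱼ` built from initial local gradients `G`. -/
def initCorrection (G : Fin n → Vec d) (i : Fin n) : Vec d := -G i + mean G

variable {Ξ Ω : Type*} [MeasurableSpace Ξ]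

/-- The averaged model `x̄⁽ᵗ⁾` of a run of K-GT whose initial corrections are built from the
(random) initial local gradients `G`. -/
def averagedModel (K : ℕ) (ηc ηs : ℝ) (W : Matrix (Fin n) (Fin n) ℝ)
    (F : Fin n → Vec d → Ξ → ℝ) (ξ : ℕ → ℕ → Fin n → Ω → Ξ) (x₀ : Vec d)
    (G : Ω → Fin n → Vec d) (t : ℕ) (ω : Ω) : Vec d :=
  mean (iterates K ηc ηs W (fun t k i x => stochGrad F i x (ξ t k i ω)) x₀
    (initCorrection (G ω)) t).1

/-- `(1/(T+1)) ∑_{t=0}^T E‖∇f(x̄⁽ᵗ⁾)‖² ≤ ε`, the expectations being finite, for the random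
sequence of averaged models `xbar`. -/
def AvgSqGradLE [MeasurableSpace Ω] (P : Measure Ω) (D : Fin n → Measure Ξ)
    (F : Fin n → Vec d → Ξ → ℝ) (xbar : ℕ → Ω → Vec d) (T : ℕ) (ε : ℝ) : Prop :=
  (∀ t ≤ T, Integrable (fun ω => ‖gradient (globalLoss D F) (xbar t ω)‖ ^ 2) P) ∧
    1 / ((T : ℝ) + 1) *
      ∑ t ∈ Finset.range (T + 1), ∫ ω, ‖gradient (globalLoss D F) (xbar t ω)‖ ^ 2 ∂P ≤ ε

end Algorithm

/-- `(σ²/(K n ε²) + σ/(p² √K ε^{3/2}) + 1/(p² ε)) · L · F₀`. -/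
def roundBound (n K : ℕ) (L σ p ε F₀ : ℝ) : ℝ :=
  (σ ^ 2 / ((K : ℝ) * n * ε ^ 2) + σ / (p ^ 2 * √(K : ℝ) * ε ^ (3 / 2 : ℝ)) + 1 / (p ^ 2 * ε))
    * L * F₀

end KGT

end

namespace KGT

/-! Take η_s = p and write λ = K η_c L. Gossip preserves means, so the corrections average to zero
in every round and x̄ moves by K p η_c times the average of the sampled local gradients. Descent of
f along x̄ therefore controls ‖∇f(x̄)‖² up to noise and the drift of the local models. By smoothness
the drift is bounded by the consensus distance, the accumulated noise, ‖∇f(x̄)‖² and the distance of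
c_i from its ideal value ∇f(x̄) - ∇f_i(x̄). Heterogeneity could enter only through this last
distance. It is never estimated by dissimilarity of the clients: gossip contracts it
(`IsMixing.correction_step`), and it starts at the error of G_i as an estimate of ∇f_i(x⁰).

Consensus and correction errors both contract by 1 - p/2 per round, up to perturbations by noise,
drift and gradient. Summing over the rounds and eliminating the two errors closes the system as soon
as λ ≤ p/1000 (`sum_sq_gradient_le_of_recursions`). The resulting bound `sum_sq_gradient_le` holds
for every realization of the oracle.

Probability enters only through the noise. The point at which a sample is used is determined by the
other samples, so the noises of a round are orthogonal to each other and to ∇f(x̄). Averages over K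
steps thus have variance σ²/K per client and σ²/(nK) for the mean, and the first-order noise term
vanishes. With b bounding the initialization error, `Run.sum_integral_sq_grad_le` bounds the sum of
E‖∇f(x̄)‖² over N rounds, up to constants, by L F₀/(pλ) + λ²b/p + N(λ²σ²/(p²K) + λpσ²/(nK)).

Finally 1/λ is 1000 times a sum of three terms (`invStep`): one enforces λ ≤ p/1000, the others make
the two noise terms small multiples of ε. None involves F₀, so the stepsizes can be fixed before the
problem. Case (a) has b = 0 and case (b) has b = σ². -/

/-- The mean square norm `(1/n) ∑ᵢ ‖vᵢ‖²` of a family of client vectors. -/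
noncomputable def meanSq {n d : ℕ} (v : Fin n → Vec d) : ℝ := (n : ℝ)⁻¹ * ∑ i, ‖v i‖ ^ 2

/-- One gossip averaging step `∑ⱼ wᵢⱼ vⱼ`. -/
noncomputable def gossip {n d : ℕ} (W : Matrix (Fin n) (Fin n) ℝ) (v : Fin n → Vec d) (i : Fin n) : Vec d :=
  ∑ j, W i j • v j

/-! ### Averages over clients and contraction by gossip. -/

section Averages

variable {n d : ℕ}

lemma norm_add_sq_le_young {E : Type*} [SeminormedAddCommGroup E] (u v : E) {a : ℝ} (ha : 0 < a) :
    ‖u + v‖ ^ 2 ≤ (1 + a) * ‖u‖ ^ 2 + (1 + 1 / a) * ‖v‖ ^ 2 := by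
  have h1 : ‖u + v‖ ^ 2 ≤ (‖u‖ + ‖v‖) ^ 2 := by gcongr; exact norm_add_le u v
  have h2 : 0 ≤ (a * ‖u‖ - ‖v‖) ^ 2 / a := by positivity
  have h3 : (a * ‖u‖ - ‖v‖) ^ 2 / a = a * ‖u‖ ^ 2 - 2 * ‖u‖ * ‖v‖ + 1 / a * ‖v‖ ^ 2 := by
    field_simp; ring
  nlinarith

lemma meanSq_nonneg (v : Fin n → Vec d) : 0 ≤ meanSq v := by
  unfold meanSq; positivity

lemma meanSq_le_meanSq {v w : Fin n → Vec d} (h : ∀ i, ‖v i‖ ≤ ‖w i‖) : meanSq v ≤ meanSq w := by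
  unfold meanSq
  gcongr with i
  exact h i

lemma meanSq_add_le_young (u v : Fin n → Vec d) {a : ℝ} (ha : 0 < a) :
    meanSq (fun i => u i + v i) ≤ (1 + a) * meanSq u + (1 + 1 / a) * meanSq v := by
  unfold meanSq
  have : ∑ i, ‖u i + v i‖ ^ 2
      ≤ (1 + a) * ∑ i, ‖u i‖ ^ 2 + (1 + 1 / a) * ∑ i, ‖v i‖ ^ 2 := by
    rw [Finset.mul_sum, Finset.mul_sum, ← Finset.sum_add_distrib]
    exact Finset.sum_le_sum fun i _ => norm_add_sq_le_young _ _ ha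
  calc _ ≤ (n : ℝ)⁻¹ * ((1 + a) * ∑ i, ‖u i‖ ^ 2 + (1 + 1 / a) * ∑ i, ‖v i‖ ^ 2) := by gcongr
    _ = _ := by ring

lemma meanSq_add_le (u v : Fin n → Vec d) :
    meanSq (fun i => u i + v i) ≤ 2 * meanSq u + 2 * meanSq v := by
  have := meanSq_add_le_young u v one_pos
  norm_num at this; exact this

lemma meanSq_sub_le (u v : Fin n → Vec d) :
    meanSq (fun i => u i - v i) ≤ 2 * meanSq u + 2 * meanSq v := by
  have := meanSq_add_le u (fun i => - v i)
  simpa [meanSq, sub_eq_add_neg] using this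

lemma meanSq_smul (a : ℝ) (v : Fin n → Vec d) :
    meanSq (fun i => a • v i) = a ^ 2 * meanSq v := by
  simp only [meanSq, norm_smul, mul_pow, ← Finset.mul_sum, Real.norm_eq_abs, sq_abs]
  ring

lemma mean_add (u v : Fin n → Vec d) : mean (fun i => u i + v i) = mean u + mean v := by
  simp [mean, Finset.sum_add_distrib]

lemma mean_sub (u v : Fin n → Vec d) : mean (fun i => u i - v i) = mean u - mean v := by
  simp [mean, Finset.sum_sub_distrib, smul_sub]

lemma mean_smul (a : ℝ) (v : Fin n → Vec d) : mean (fun i => a • v i) = a • mean v := by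
  simp [mean, ← Finset.smul_sum, smul_comm a]

lemma mean_const (hn : 1 ≤ n) (v : Vec d) : mean (fun _ : Fin n => v) = v := by
  have : (n : ℝ) ≠ 0 := by positivity
  simp [mean, ← Nat.cast_smul_eq_nsmul ℝ, smul_smul, this]

/-- Bias-variance decomposition. -/
lemma meanSq_sub_mean (hn : 1 ≤ n) (v : Fin n → Vec d) :
    meanSq (fun i => v i - mean v) = meanSq v - ‖mean v‖ ^ 2 := by
  have hn0 : (n : ℝ) ≠ 0 := by positivity
  have hs : ∑ i, v i = (n : ℝ) • mean v := by simp [mean, smul_smul, hn0]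
  have h1 : ∑ i, inner ℝ (v i) (mean v) = n * ‖mean v‖ ^ 2 := by
    rw [← sum_inner, hs, real_inner_smul_left, real_inner_self_eq_norm_sq]
  simp only [meanSq, norm_sub_sq_real, Finset.sum_add_distrib, Finset.sum_sub_distrib,
    ← Finset.mul_sum, h1]
  simp
  field_simp
  ring

lemma meanSq_sub_mean_le (hn : 1 ≤ n) (v : Fin n → Vec d) :
    meanSq (fun i => v i - mean v) ≤ meanSq v := by
  rw [meanSq_sub_mean hn]; nlinarith [sq_nonneg ‖mean v‖]

lemma norm_mean_sq_le (hn : 1 ≤ n) (v : Fin n → Vec d) : ‖mean v‖ ^ 2 ≤ meanSq v := by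
  have := meanSq_nonneg (fun i => v i - mean v)
  rw [meanSq_sub_mean hn] at this; linarith

/-- The mean minimizes the mean square distance. -/
lemma meanSq_sub_mean_le_sub (hn : 1 ≤ n) (v : Fin n → Vec d) (a : Vec d) :
    meanSq (fun i => v i - mean v) ≤ meanSq (fun i => v i - a) := by
  have := meanSq_sub_mean_le hn (fun i => v i - a)
  rw [mean_sub, mean_const hn] at this
  simpa using this

lemma meanSq_const (hn : 1 ≤ n) (v : Vec d) : meanSq (fun _ : Fin n => v) = ‖v‖ ^ 2 := by
  have : (n : ℝ) ≠ 0 := by positivity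
  simp [meanSq, this]

lemma norm_sum_sq_le {E ι : Type*} [SeminormedAddCommGroup E] (s : Finset ι) (v : ι → E) :
    ‖∑ i ∈ s, v i‖ ^ 2 ≤ s.card * ∑ i ∈ s, ‖v i‖ ^ 2 := by
  calc _ ≤ (∑ i ∈ s, ‖v i‖) ^ 2 := by gcongr; exact norm_sum_le _ _
    _ ≤ _ := sq_sum_le_card_mul_sum_sq

variable {p : ℝ} {W : Matrix (Fin n) (Fin n) ℝ}

lemma IsMixing.mean_gossip (hW : IsMixing d p W) (v : Fin n → Vec d) :
    mean (gossip W v) = mean v := by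
  unfold mean gossip
  rw [Finset.sum_comm]
  simp [← Finset.sum_smul, hW.col_sum]

lemma IsMixing.meanSq_gossip_sub_le (hW : IsMixing d p W) (v : Fin n → Vec d) :
    meanSq (fun i => gossip W v i - mean v) ≤ (1 - p) * meanSq (fun i => v i - mean v) := by
  have h := hW.mixing v
  unfold meanSq gossip
  simp only [hW.symm.apply] at h
  calc _ ≤ (n : ℝ)⁻¹ * ((1 - p) * ∑ i, ‖v i - mean v‖ ^ 2) := by gcongr
    _ = _ := by ring

/-- Both terms have the same mean, so it can be subtracted from each; neither centred part exceeds
`meanSq v`. -/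
lemma IsMixing.meanSq_sub_gossip_le (hW : IsMixing d p W) (hn : 1 ≤ n) (hp : 0 ≤ p)
    (v : Fin n → Vec d) :
    meanSq (fun i => v i - gossip W v i) ≤ 4 * meanSq v := by
  have h1 := meanSq_sub_le (fun i => v i - mean v) (fun i => gossip W v i - mean v)
  have h2 := hW.meanSq_gossip_sub_le v
  have h3 := meanSq_sub_mean_le hn v
  have h4 := meanSq_nonneg (fun i => v i - mean v)
  simp only [sub_sub_sub_cancel_right] at h1
  nlinarith

/-- A gossip step contracts a centred family, up to a perturbation. -/
lemma IsMixing.meanSq_gossip_add_le (hW : IsMixing d p W) (hp : 0 < p) (hp1 : p ≤ 1)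
    {v : Fin n → Vec d} (hv : mean v = 0) (w : Fin n → Vec d) :
    meanSq (fun i => gossip W v i + w i) ≤ (1 - p / 2) * meanSq v + 3 / p * meanSq w := by
  -- Young's inequality with a = p/2: (1 + p/2)(1 - p) ≤ 1 - p/2, and 1 + 2/p ≤ 3/p because p ≤ 1.
  have h1 := meanSq_add_le_young (gossip W v) w (half_pos hp)
  have h2 := hW.meanSq_gossip_sub_le v
  simp only [hv, sub_zero] at h2
  have h3 : (1 + p / 2) * meanSq (fun i => gossip W v i) ≤ (1 + p / 2) * ((1 - p) * meanSq v) := by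
    gcongr
  have h4 : (1 + 1 / (p / 2)) * meanSq w ≤ 3 / p * meanSq w := by
    gcongr
    · exact meanSq_nonneg w
    · field_simp; linarith
  nlinarith [meanSq_nonneg v, mul_nonneg (sq_nonneg p) (meanSq_nonneg v)]

end Averages

/-! ### Drift of a client during local steps. -/

section LocalSteps

variable {n d : ℕ}

lemma localSteps_eq (ηc : ℝ) (g : ℕ → Fin n → Vec d → Vec d) (x c : Fin n → Vec d) (k : ℕ)
    (i : Fin n) :
    localSteps ηc g x c k i
      = x i - ηc • ∑ j ∈ Finset.range k, (g j i (localSteps ηc g x c j i) + c i) := by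
  induction k with
  | zero => simp [localSteps]
  | succ k ih =>
    rw [Finset.sum_range_succ, smul_add, ← sub_sub, ← ih, localSteps]

lemma tracking_eq {K : ℕ} (hK : 1 ≤ K) {ηc : ℝ} (hη : ηc ≠ 0) (g : ℕ → Fin n → Vec d → Vec d)
    (x c : Fin n → Vec d) (i : Fin n) :
    tracking K ηc g x c i
      = (K : ℝ)⁻¹ • ∑ j ∈ Finset.range K, g j i (localSteps ηc g x c j i) + c i := by
  have hK0 : (K : ℝ) ≠ 0 := by positivity
  rw [tracking, localSteps_eq, sub_sub_cancel, smul_smul, Finset.sum_add_distrib, smul_add]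
  have h1 : ((K : ℝ) * ηc)⁻¹ * ηc = (K : ℝ)⁻¹ := by field_simp
  rw [h1]
  simp [← Nat.cast_smul_eq_nsmul ℝ, smul_smul, hK0]

/-- Drift of one client away from the point `a` in a round of `K` noisy local steps. -/
lemma sum_norm_drift_le {K : ℕ} {ηc L : ℝ}
    (hηL : 8 * (K * ηc * L) ^ 2 ≤ 1) (h : Vec d → Vec d)
    (hLip : ∀ x y, ‖h x - h y‖ ≤ L * ‖x - y‖) (x c a : Vec d) (y s : ℕ → Vec d)
    (hy : ∀ k, y k = x - ηc • ∑ j ∈ Finset.range k, (h (y j) + s j + c)) :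
    ∑ k ∈ Finset.range K, ‖y k - a‖ ^ 2 ≤ 8 * (K * ‖x - a‖ ^ 2 + K * (K * ηc) ^ 2 * ‖h a + c‖ ^ 2
      + ηc ^ 2 * ∑ k ∈ Finset.range K, ‖∑ j ∈ Finset.range k, s j‖ ^ 2) := by
  set Y := ∑ k ∈ Finset.range K, ‖y k - a‖ ^ 2 with hY
  have hY0 : 0 ≤ Y := by positivity
  have key : ∀ k ∈ Finset.range K, ‖y k - a‖ ^ 2 ≤ 4 * (‖x - a‖ ^ 2 + (K * ηc) ^ 2 * ‖h a + c‖ ^ 2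
      + ηc ^ 2 * ‖∑ j ∈ Finset.range k, s j‖ ^ 2 + ηc ^ 2 * (K * (L ^ 2 * Y))) := by
    intro k hk
    have hkK : k ≤ K := (Finset.mem_range.1 hk).le
    -- The noise is kept as one partial sum rather than bounded term by term: its orthogonality will
    -- give variance of order k instead of k².
    have e : y k - a = (x - a) + (-((k : ℝ) * ηc)) • (h a + c)
        + (-ηc) • ∑ j ∈ Finset.range k, s j
        + (-ηc) • ∑ j ∈ Finset.range k, (h (y j) - h a) := by
      rw [hy k]
      simp only [Finset.sum_add_distrib, Finset.sum_sub_distrib, Finset.sum_const,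
        Finset.card_range, ← Nat.cast_smul_eq_nsmul ℝ]
      module
    have h4 : ∀ a b c d : Vec d, ‖a + b + c + d‖ ^ 2
        ≤ 4 * (‖a‖ ^ 2 + ‖b‖ ^ 2 + ‖c‖ ^ 2 + ‖d‖ ^ 2) := by
      intro a b c d
      have h1 := norm_add_sq_le_young (a + b) (c + d) one_pos
      have h2 := norm_add_sq_le_young a b one_pos
      have h3 := norm_add_sq_le_young c d one_pos
      rw [← add_assoc] at h1
      linarith
    rw [e]
    refine (h4 _ _ _ _).trans ?_
    simp only [norm_smul, mul_pow, norm_neg, Real.norm_eq_abs, sq_abs, abs_mul]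
    have hk2 : (k : ℝ) ^ 2 ≤ (K : ℝ) ^ 2 := by gcongr
    have hd : ‖∑ j ∈ Finset.range k, (h (y j) - h a)‖ ^ 2 ≤ K * (L ^ 2 * Y) := by
      refine (norm_sum_sq_le _ _).trans ?_
      rw [Finset.card_range]
      have : ∑ j ∈ Finset.range k, ‖h (y j) - h a‖ ^ 2 ≤ L ^ 2 * Y := by
        rw [hY, Finset.mul_sum]
        refine (Finset.sum_le_sum_of_subset_of_nonneg (Finset.range_mono hkK)
          (fun _ _ _ => by positivity)).trans (Finset.sum_le_sum fun j _ => ?_)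
        rw [← mul_pow]
        gcongr
        exact hLip _ _
      gcongr
    gcongr
  have := Finset.sum_le_sum key
  rw [← hY, ← Finset.mul_sum, Finset.sum_add_distrib, Finset.sum_add_distrib,
    ← Finset.mul_sum] at this
  simp only [Finset.sum_const, Finset.card_range, nsmul_eq_mul] at this
  -- The Lipschitz term feeds `Y` back into its own bound with coefficient 4(KηcL)² ≤ 1/2; absorbing
  -- it doubles the factor 4 to 8.
  have h2 : 8 * ((K * ηc * L) ^ 2 * Y) ≤ Y := by nlinarith
  nlinarith

end LocalSteps

/-! ### One communication round: drift, consensus, corrections, descent. -/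

section Round

variable {n d : ℕ}

/-- The accumulated gradient noise of the first `k` local steps of a round. -/
noncomputable def roundNoise (ηc : ℝ) (h : Fin n → Vec d → Vec d) (g : ℕ → Fin n → Vec d → Vec d)
    (x c : Fin n → Vec d) (k : ℕ) (i : Fin n) : Vec d :=
  ∑ j ∈ Finset.range k, (g j i (localSteps ηc g x c j i) - h i (localSteps ηc g x c j i))

/-- The mean square distance of the local models of a round to the averaged model. -/
noncomputable def roundDrift (K : ℕ) (ηc : ℝ) (g : ℕ → Fin n → Vec d → Vec d)
    (x c : Fin n → Vec d) : ℝ :=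
  (n : ℝ)⁻¹ * ∑ i, (K : ℝ)⁻¹ * ∑ k ∈ Finset.range K, ‖localSteps ηc g x c k i - mean x‖ ^ 2

/-- The difference of the corrections from the ideal ones `∇f(x̄) - ∇fᵢ(x̄)`. -/
noncomputable def correctionError (h : Fin n → Vec d → Vec d) (x c : Fin n → Vec d)
    (i : Fin n) : Vec d :=
  c i + h i (mean x) - mean fun j => h j (mean x)

variable {K : ℕ} {ηc L p : ℝ} {h : Fin n → Vec d → Vec d}

/-- The direction ∇f_i(x̄) + c_i of a client is the correction error plus ∇f(x̄), so no individual
gradient norm survives. -/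
lemma roundDrift_le (hn : 1 ≤ n) (hK : 1 ≤ K) (hηL : 8 * (K * ηc * L) ^ 2 ≤ 1)
    (hLip : ∀ i x y, ‖h i x - h i y‖ ≤ L * ‖x - y‖) (g : ℕ → Fin n → Vec d → Vec d)
    (x c : Fin n → Vec d) :
    L ^ 2 * roundDrift K ηc g x c ≤ 8 * (L ^ 2 * meanSq (fun i => x i - mean x)
      + (K * ηc * L) ^ 2 * (2 * meanSq (correctionError h x c)
        + 2 * ‖mean fun j => h j (mean x)‖ ^ 2)
      + (K * ηc * L) ^ 2 / K ^ 2 * ((n : ℝ)⁻¹ * ∑ i, (K : ℝ)⁻¹ * ∑ k ∈ Finset.range K,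
        ‖roundNoise ηc h g x c k i‖ ^ 2)) := by
  have hK0 : (0 : ℝ) < K := by positivity
  have h1 : ∀ i, (K : ℝ)⁻¹ * ∑ k ∈ Finset.range K, ‖localSteps ηc g x c k i - mean x‖ ^ 2
      ≤ 8 * (‖x i - mean x‖ ^ 2 + (K * ηc) ^ 2 * ‖h i (mean x) + c i‖ ^ 2
        + ηc ^ 2 * ((K : ℝ)⁻¹ * ∑ k ∈ Finset.range K, ‖roundNoise ηc h g x c k i‖ ^ 2)) := by
    intro i
    have := sum_norm_drift_le hηL (h i) (hLip i) (x i) (c i) (mean x)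
      (fun k => localSteps ηc g x c k i)
      (fun j => g j i (localSteps ηc g x c j i) - h i (localSteps ηc g x c j i))
      (fun k => by simp only [add_sub_cancel]; exact localSteps_eq ηc g x c k i)
    calc _ ≤ (K : ℝ)⁻¹ * _ := mul_le_mul_of_nonneg_left this (by positivity)
      _ = _ := by unfold roundNoise; field_simp
  have h2 : roundDrift K ηc g x c ≤ 8 * (meanSq (fun i => x i - mean x)
      + (K * ηc) ^ 2 * meanSq (fun i => h i (mean x) + c i)
      + ηc ^ 2 * ((n : ℝ)⁻¹ * ∑ i, (K : ℝ)⁻¹ * ∑ k ∈ Finset.range K,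
        ‖roundNoise ηc h g x c k i‖ ^ 2)) := by
    unfold roundDrift
    refine (mul_le_mul_of_nonneg_left (Finset.sum_le_sum fun i _ => h1 i)
      (by positivity)).trans_eq ?_
    unfold meanSq
    simp only [← Finset.mul_sum, Finset.sum_add_distrib]
    ring
  have h3 : meanSq (fun i => h i (mean x) + c i) ≤ 2 * meanSq (correctionError h x c)
      + 2 * ‖mean fun j => h j (mean x)‖ ^ 2 := by
    have := meanSq_add_le (correctionError h x c) (fun _ => mean fun j => h j (mean x))
    rw [meanSq_const hn] at this
    refine le_trans (le_of_eq ?_) this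
    congr 1; ext1 i; simp only [correctionError]; abel
  calc _ ≤ L ^ 2 * (8 * (meanSq (fun i => x i - mean x)
      + (K * ηc) ^ 2 * (2 * meanSq (correctionError h x c)
      + 2 * ‖mean fun j => h j (mean x)‖ ^ 2)
      + ηc ^ 2 * ((n : ℝ)⁻¹ * ∑ i, (K : ℝ)⁻¹ * ∑ k ∈ Finset.range K,
        ‖roundNoise ηc h g x c k i‖ ^ 2))) := by
        refine (mul_le_mul_of_nonneg_left h2 (by positivity)).trans ?_
        gcongr
    _ = _ := by field_simp

/-- The average over the local steps of the true local gradients is close to the gradient at the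
averaged model. -/
lemma meanSq_avg_gradient_sub_le (hK : 1 ≤ K)
    (hLip : ∀ i x y, ‖h i x - h i y‖ ≤ L * ‖x - y‖) (g : ℕ → Fin n → Vec d → Vec d)
    (x c : Fin n → Vec d) :
    meanSq (fun i => (K : ℝ)⁻¹ • ∑ j ∈ Finset.range K, h i (localSteps ηc g x c j i)
      - h i (mean x)) ≤ L ^ 2 * roundDrift K ηc g x c := by
  have hK0 : (0 : ℝ) < K := by positivity
  have h1 : ∀ i, ‖(K : ℝ)⁻¹ • ∑ j ∈ Finset.range K, h i (localSteps ηc g x c j i)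
      - h i (mean x)‖ ^ 2
      ≤ L ^ 2 * ((K : ℝ)⁻¹ * ∑ k ∈ Finset.range K, ‖localSteps ηc g x c k i - mean x‖ ^ 2) := by
    intro i
    have e : (K : ℝ)⁻¹ • ∑ j ∈ Finset.range K, h i (localSteps ηc g x c j i) - h i (mean x)
        = (K : ℝ)⁻¹ • ∑ j ∈ Finset.range K, (h i (localSteps ηc g x c j i) - h i (mean x)) := by
      rw [Finset.sum_sub_distrib, smul_sub]
      simp [← Nat.cast_smul_eq_nsmul ℝ, smul_smul, hK0.ne']
    rw [e, norm_smul, mul_pow, Real.norm_eq_abs, sq_abs]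
    have h2 := norm_sum_sq_le (Finset.range K)
      (fun j => h i (localSteps ηc g x c j i) - h i (mean x))
    rw [Finset.card_range] at h2
    have h3 : ∑ j ∈ Finset.range K, ‖h i (localSteps ηc g x c j i) - h i (mean x)‖ ^ 2
        ≤ L ^ 2 * ∑ k ∈ Finset.range K, ‖localSteps ηc g x c k i - mean x‖ ^ 2 := by
      rw [Finset.mul_sum]
      refine Finset.sum_le_sum fun j _ => ?_
      rw [← mul_pow]
      gcongr
      exact hLip _ _ _
    calc _ ≤ (K : ℝ)⁻¹ ^ 2 * (K * (L ^ 2 * ∑ k ∈ Finset.range K,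
          ‖localSteps ηc g x c k i - mean x‖ ^ 2)) := by
            refine mul_le_mul_of_nonneg_left (h2.trans ?_) (by positivity)
            gcongr
      _ = _ := by field_simp
  unfold meanSq roundDrift
  refine (mul_le_mul_of_nonneg_left (Finset.sum_le_sum fun i _ => h1 i)
      (by positivity)).trans_eq ?_
  rw [← Finset.mul_sum]; ring

lemma avg_oracle_eq (g : ℕ → Fin n → Vec d → Vec d) (x c : Fin n → Vec d) (i : Fin n) :
    (K : ℝ)⁻¹ • ∑ j ∈ Finset.range K, g j i (localSteps ηc g x c j i)
      = (K : ℝ)⁻¹ • ∑ j ∈ Finset.range K, h i (localSteps ηc g x c j i)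
        + (K : ℝ)⁻¹ • roundNoise ηc h g x c K i := by
  rw [← smul_add, roundNoise, ← Finset.sum_add_distrib]
  simp

lemma meanSq_avg_oracle_sub_le (hK : 1 ≤ K)
    (hLip : ∀ i x y, ‖h i x - h i y‖ ≤ L * ‖x - y‖) (g : ℕ → Fin n → Vec d → Vec d)
    (x c : Fin n → Vec d) :
    meanSq (fun i => (K : ℝ)⁻¹ • ∑ j ∈ Finset.range K, g j i (localSteps ηc g x c j i)
      - h i (mean x)) ≤ 2 * (L ^ 2 * roundDrift K ηc g x c)
        + 2 * meanSq (fun i => (K : ℝ)⁻¹ • roundNoise ηc h g x c K i) := by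
  have h1 := meanSq_add_le
    (fun i => (K : ℝ)⁻¹ • ∑ j ∈ Finset.range K, h i (localSteps ηc g x c j i) - h i (mean x))
    (fun i => (K : ℝ)⁻¹ • roundNoise ηc h g x c K i)
  have h2 := meanSq_avg_gradient_sub_le (ηc := ηc) hK hLip g x c
  simp only [avg_oracle_eq (h := h), add_sub_right_comm]
  linarith

variable {W : Matrix (Fin n) (Fin n) ℝ}

/-- The new deviation is the gossiped old one minus η times the deviation of the gossiped z from its
mean. The centre `a` is free because the mean minimizes the mean square distance. -/
lemma IsMixing.consensus_step (hW : IsMixing d p W) (hn : 1 ≤ n) (hp : 0 < p) (hp1 : p ≤ 1)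
    (x z : Fin n → Vec d) (a : Vec d) (η : ℝ) :
    mean (gossip W fun j => x j - η • z j) = mean x - η • mean z ∧
    meanSq (fun i => gossip W (fun j => x j - η • z j) i
        - mean (gossip W fun j => x j - η • z j))
      ≤ (1 - p / 2) * meanSq (fun i => x i - mean x)
        + 3 * η ^ 2 / p * meanSq (fun i => z i - a) := by
  have hm : mean (gossip W fun j => x j - η • z j) = mean x - η • mean z := by
    rw [hW.mean_gossip, mean_sub, mean_smul]
  refine ⟨hm, ?_⟩
  have hg : ∀ (v : Vec d) (i : Fin n), ∑ j, W i j • v = v := fun v i => by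
    rw [← Finset.sum_smul, hW.row_sum, one_smul]
  have h1 := hW.meanSq_gossip_add_le hp hp1 (v := fun i => x i - mean x)
    (by rw [mean_sub, mean_const hn, sub_self]) (fun i => (-η) • (gossip W z i - mean z))
  have h2 : meanSq (fun i => gossip W z i - mean z) ≤ meanSq (fun i => z i - a) := by
    have a1 := hW.meanSq_gossip_sub_le z
    have a2 := meanSq_sub_mean_le_sub hn z a
    have a3 := meanSq_nonneg (fun i => z i - mean z)
    nlinarith
  have e : (fun i => gossip W (fun j => x j - η • z j) i
        - mean (gossip W fun j => x j - η • z j))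
      = fun i => gossip W (fun i => x i - mean x) i + (-η) • (gossip W z i - mean z) := by
    ext1 i
    rw [hm]
    simp only [gossip, smul_sub, Finset.sum_sub_distrib, hg, smul_comm _ η,
      ← Finset.smul_sum, neg_smul]
    abel
  rw [e]
  rw [meanSq_smul] at h1
  calc _ ≤ _ := h1
    _ ≤ (1 - p / 2) * meanSq (fun i => x i - mean x)
        + 3 / p * ((-η) ^ 2 * meanSq (fun i => z i - a)) := by gcongr
    _ = _ := by ring

lemma correctionError_mean (hn : 1 ≤ n) (x c : Fin n → Vec d) (hc : mean c = 0) :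
    mean (correctionError h x c) = 0 := by
  unfold correctionError
  rw [mean_sub, mean_add, mean_const hn, hc]; simp

/-- The update collapses to c' = Wc - (u - Wu). Writing u as ∇f_i(x̄) plus a deviation w, the local
gradients at x̄ combine with c into the gossiped old correction error. What remains is w - Ww and
the centred change of the local gradients from x̄ to x̄', both free of heterogeneity. -/
lemma IsMixing.correction_step (hW : IsMixing d p W) (hn : 1 ≤ n) (hp : 0 < p) (hp1 : p ≤ 1)
    (hLip : ∀ i x y, ‖h i x - h i y‖ ≤ L * ‖x - y‖)
    (x c u x' : Fin n → Vec d) (hc : mean c = 0) (c' : Fin n → Vec d)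
    (hc' : ∀ i, c' i = c i - (u i + c i) + ∑ j, W i j • (u j + c j)) :
    mean c' = 0 ∧
    meanSq (correctionError h x' c') ≤ (1 - p / 2) * meanSq (correctionError h x c)
      + 3 / p * (8 * meanSq (fun i => u i - h i (mean x))
        + 2 * (L ^ 2 * ‖mean x' - mean x‖ ^ 2)) := by
  have hc'' : c' = fun i => c i - (u i + c i) + gossip W (fun j => u j + c j) i := funext hc'
  constructor
  · rw [hc'', mean_add, hW.mean_gossip, mean_sub, hc]
    simp
  have hg : ∀ (v : Vec d) (i : Fin n), ∑ j, W i j • v = v := fun v i => by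
    rw [← Finset.sum_smul, hW.row_sum, one_smul]
  set w : Fin n → Vec d := fun i => u i - h i (mean x) with hw
  set k : Fin n → Vec d := fun i => h i (mean x') - h i (mean x) with hk
  have e : correctionError h x' c' = fun i => gossip W (correctionError h x c) i
      + (-(w i - gossip W w i) + (k i - mean k)) := by
    ext1 i
    rw [hk, mean_sub, hw, hc'']
    simp only [correctionError, gossip, smul_add, smul_sub, Finset.sum_sub_distrib,
      Finset.sum_add_distrib, hg]
    abel
  have h1 := hW.meanSq_gossip_add_le hp hp1 (correctionError_mean (h := h) hn x c hc)
    (fun i => -(w i - gossip W w i) + (k i - mean k))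
  have h2 := meanSq_add_le (fun i => -(w i - gossip W w i)) (fun i => k i - mean k)
  have h3 : meanSq (fun i => -(w i - gossip W w i)) ≤ 4 * meanSq w := by
    refine le_trans (le_of_eq ?_) (hW.meanSq_sub_gossip_le hn hp.le w)
    simp only [meanSq, norm_neg]
  have h4 : meanSq (fun i => k i - mean k) ≤ L ^ 2 * ‖mean x' - mean x‖ ^ 2 := by
    refine (meanSq_sub_mean_le hn k).trans ?_
    have : meanSq k ≤ meanSq (fun _ : Fin n => L • (mean x' - mean x)) := by
      refine meanSq_le_meanSq fun i => (hLip i _ _).trans ?_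
      rw [norm_smul, Real.norm_eq_abs]
      gcongr
      exact le_abs_self L
    rw [meanSq_const hn, norm_smul, mul_pow, Real.norm_eq_abs, sq_abs] at this
    exact this
  rw [e]
  refine h1.trans ?_
  gcongr
  linarith

/-- A descent lemma for functions with Lipschitz gradient. -/
lemma le_add_inner_of_lipschitz_gradient {f : Vec d → ℝ} {f' : Vec d → Vec d}
    (hf : ∀ x, HasGradientAt f (f' x) x)
    (hLip : ∀ x y, ‖f' x - f' y‖ ≤ L * ‖x - y‖) (hL : 0 ≤ L) (x y : Vec d) :
    f y ≤ f x + inner ℝ (f' x) (y - x) + L * ‖y - x‖ ^ 2 := by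
  -- A single intermediate point suffices, at the price of the constant L in place of L/2.
  obtain ⟨z, hz, hzeq⟩ := domain_mvt (f := f) (f' := fun x => InnerProductSpace.toDual ℝ _ (f' x))
    (s := Set.univ) (fun x _ => (hf x).hasFDerivAt.hasFDerivWithinAt) convex_univ
    (Set.mem_univ x) (Set.mem_univ y)
  rw [InnerProductSpace.toDual_apply_apply] at hzeq
  have h1 : inner ℝ (f' z - f' x) (y - x) ≤ L * ‖y - x‖ ^ 2 := by
    refine (real_inner_le_norm _ _).trans ?_
    have : ‖f' z - f' x‖ ≤ L * ‖y - x‖ := by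
      refine (hLip z x).trans ?_
      gcongr
      exact norm_sub_le_of_mem_segment hz
    nlinarith [norm_nonneg (y - x)]
  rw [inner_sub_left] at h1
  linarith

/-- Descent of the objective along the averaged model. -/
lemma descent_step {f : Vec d → ℝ} {f' : Vec d → Vec d}
    (hf : ∀ x, HasGradientAt f (f' x) x)
    (hLip : ∀ x y, ‖f' x - f' y‖ ≤ L * ‖x - y‖) (hL : 0 ≤ L) {η : ℝ} (hη : 0 ≤ η)
    (hηL : 4 * (L * η) ≤ 1) (x u ν : Vec d) :
    f (x - η • (u + ν)) ≤ f x - η * inner ℝ (f' x) ν - η / 2 * ‖f' x‖ ^ 2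
      + η / 2 * ‖u - f' x‖ ^ 2 + 2 * L * η ^ 2 * ‖ν‖ ^ 2 := by
  have h1 := le_add_inner_of_lipschitz_gradient hf hLip hL x (x - η • (u + ν))
  rw [sub_sub_cancel_left, norm_neg, norm_smul, mul_pow, Real.norm_eq_abs, sq_abs,
    inner_neg_right, real_inner_smul_right, inner_add_right] at h1
  have h2 := norm_add_sq_le_young u ν one_pos
  -- Polarization turns the inner product of f' x and u into squares; its -(η/2)‖u‖² absorbs the
  -- second-order contribution of u since 4Lη ≤ 1. The inner product with ν is left intact because
  -- its expectation will vanish.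
  have h3 := norm_sub_sq_real u (f' x)
  rw [real_inner_comm] at h3
  have h4 : L * (η ^ 2 * ‖u + ν‖ ^ 2) ≤ L * (η ^ 2 * (2 * ‖u‖ ^ 2 + 2 * ‖ν‖ ^ 2)) := by
    gcongr; linarith
  have h5 : η * (4 * (L * η)) * ‖u‖ ^ 2 ≤ η * 1 * ‖u‖ ^ 2 := by gcongr
  nlinarith

end Round

/-! ### Closing the coupled recursions. -/

section Recursions

/-- Summing a contraction with a perturbation. -/
lemma sum_le_of_contraction {u b : ℕ → ℝ} {q : ℝ} (hu : ∀ t, 0 ≤ u t)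
    (h : ∀ t, u (t + 1) ≤ (1 - q) * u t + b t) (N : ℕ) :
    q * ∑ t ∈ Finset.range N, u t ≤ u 0 + ∑ t ∈ Finset.range N, b t := by
  have : q * ∑ t ∈ Finset.range N, u t + u N ≤ u 0 + ∑ t ∈ Finset.range N, b t := by
    induction N with
    | zero => simp
    | succ N ih =>
      rw [Finset.sum_range_succ, Finset.sum_range_succ]
      linarith [h N]
  linarith [hu N]

/-- The Lyapunov-type argument that closes the system of recursions for the consensus error `a`,
the correction error `γ`, the drift `δ`, the squared gradient `g` and the objective `f`, driven by
the noise terms `R`, `Q`, `M`, `I`. -/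
lemma sum_sq_gradient_le_of_recursions {a γ δ g R Q M I f : ℕ → ℝ} {lam p L η k fmin : ℝ}
    (hp : 0 < p) (hp1 : p ≤ 1) (hlam : 0 ≤ lam) (hlamp : 1000 * lam ≤ p) (hη : 0 < η)
    (ha : ∀ t, 0 ≤ a t) (hγ : ∀ t, 0 ≤ γ t) (hδ : ∀ t, 0 ≤ δ t) (hg : ∀ t, 0 ≤ g t)
    (hR : ∀ t, 0 ≤ R t) (ha0 : a 0 = 0)
    (drift : ∀ t, δ t ≤ 8 * (a t + lam ^ 2 * (2 * γ t + 2 * g t) + lam ^ 2 / k ^ 2 * Q t))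
    (cons : ∀ t, a (t + 1) ≤ (1 - p / 2) * a t
      + 3 * (lam * p) ^ 2 / p * (4 * R t + 4 * δ t + 2 * γ t))
    (corr : ∀ t, γ (t + 1) ≤ (1 - p / 2) * γ t
      + 3 / p * (8 * (2 * δ t + 2 * R t) + 2 * ((lam * p) ^ 2 * (2 * g t + 4 * δ t + 4 * R t))))
    (desc : ∀ t, f (t + 1) ≤ f t - η * I t - η / 2 * g t + η / 2 * δ t + 2 * L * η ^ 2 * M t)
    (hf : ∀ t, fmin ≤ f t) (N : ℕ) :
    1 / 4 * ∑ t ∈ Finset.range N, g t ≤ (f 0 - fmin) / η - ∑ t ∈ Finset.range N, I t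
      + 832 * lam ^ 2 / p * γ 0 + 60288 * lam ^ 2 / p ^ 2 * ∑ t ∈ Finset.range N, R t
      + 16 * lam ^ 2 / k ^ 2 * ∑ t ∈ Finset.range N, Q t
      + 2 * L * η * ∑ t ∈ Finset.range N, M t := by
  set A := ∑ t ∈ Finset.range N, a t with hA
  set Γ := ∑ t ∈ Finset.range N, γ t with hΓ
  set D := ∑ t ∈ Finset.range N, δ t with hD
  set G := ∑ t ∈ Finset.range N, g t with hG
  set SR := ∑ t ∈ Finset.range N, R t with hSR
  set SQ := ∑ t ∈ Finset.range N, Q t with hSQ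
  set SM := ∑ t ∈ Finset.range N, M t with hSM
  set SI := ∑ t ∈ Finset.range N, I t with hSI
  have hG0 : 0 ≤ G := Finset.sum_nonneg fun t _ => hg t
  have hD0 : 0 ≤ D := Finset.sum_nonneg fun t _ => hδ t
  have hR0 : 0 ≤ SR := Finset.sum_nonneg fun t _ => hR t
  have hΓ0 : 0 ≤ Γ := Finset.sum_nonneg fun t _ => hγ t
  have hl1 : lam ≤ 1 / 1000 := by linarith
  have hlp : lam ^ 2 ≤ p ^ 2 / 1000000 := by nlinarith
  have hl2 : lam ^ 2 ≤ 1 / 1000000 := by nlinarith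
  have hlp1 : (lam * p) ^ 2 ≤ 1 := by
    have : lam * p ≤ 1 := by nlinarith
    nlinarith [mul_nonneg hlam hp.le]
  have e1 : D ≤ 8 * (A + lam ^ 2 * (2 * Γ + 2 * G) + lam ^ 2 / k ^ 2 * SQ) := by
    refine (Finset.sum_le_sum fun t _ => drift t).trans_eq ?_
    simp only [← Finset.mul_sum, Finset.sum_add_distrib, ← hA, ← hΓ, ← hG, ← hSQ]
  have e2 : p / 2 * A ≤ 3 * (lam * p) ^ 2 / p * (4 * SR + 4 * D + 2 * Γ) := by
    have := sum_le_of_contraction ha cons N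
    rw [ha0, zero_add] at this
    refine this.trans_eq ?_
    simp only [← Finset.mul_sum, Finset.sum_add_distrib, ← hD, ← hΓ, ← hSR]
  have e3 : p / 2 * Γ ≤ γ 0
      + 3 / p * (8 * (2 * D + 2 * SR) + 2 * ((lam * p) ^ 2 * (2 * G + 4 * D + 4 * SR))) := by
    refine (sum_le_of_contraction hγ corr N).trans_eq ?_
    simp only [← Finset.mul_sum, Finset.sum_add_distrib, ← hD, ← hG, ← hSR]
  have e4 : η / 2 * G ≤ f 0 - fmin - η * SI + η / 2 * D + 2 * L * η ^ 2 * SM := by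
    have : f N - f 0 ≤ -(η * SI) - η / 2 * G + η / 2 * D + 2 * L * η ^ 2 * SM := by
      rw [← Finset.sum_range_sub f N]
      refine (Finset.sum_le_sum fun t _ => (by linarith [desc t] : f (t + 1) - f t
        ≤ -(η * I t) - η / 2 * g t + η / 2 * δ t + 2 * L * η ^ 2 * M t)).trans_eq ?_
      simp only [← Finset.mul_sum, Finset.sum_add_distrib, Finset.sum_sub_distrib,
        Finset.sum_neg_distrib, ← hD, ← hG, ← hSI, ← hSM]
    linarith [hf N]
  have hγ0 := hγ 0
  clear_value A Γ D G SR SQ SM SI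
  clear ha hδ hg hR hγ ha0 drift cons corr desc hf hA hΓ hD hG hSR hSQ hSM hSI
  -- One factor 1/p comes from summing the contraction and one from Young's inequality. The choice
  -- η_s = p supplies the p² that cancels both.
  have e2' : A ≤ 24 * lam ^ 2 * (SR + D + Γ) := by
    have h : A ≤ 2 / p * (3 * (lam * p) ^ 2 / p * (4 * SR + 4 * D + 2 * Γ)) := by
      calc A = 2 / p * (p / 2 * A) := by field_simp
        _ ≤ _ := by gcongr
    have h' : 2 / p * (3 * (lam * p) ^ 2 / p * (4 * SR + 4 * D + 2 * Γ))
        = lam ^ 2 * (24 * SR + 24 * D + 12 * Γ) := by field_simp; ring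
    nlinarith [mul_nonneg (sq_nonneg lam) hΓ0]
  -- Here (λp)² is kept in front of `G`, where it cancels 1/p², and bounded by 1 in front of `D` and
  -- `SR`.
  have e3' : lam ^ 2 * Γ ≤ 2 * lam ^ 2 / p * γ 0 + 144 * lam ^ 2 / p ^ 2 * (SR + D)
      + 24 * lam ^ 4 * G := by
    have h : lam ^ 2 * Γ ≤ lam ^ 2 * (2 / p) * (γ 0 + 3 / p * (8 * (2 * D + 2 * SR)
        + (2 * ((lam * p) ^ 2 * (2 * G)) + 2 * (1 * (4 * D + 4 * SR))))) := by
      calc lam ^ 2 * Γ = lam ^ 2 * (2 / p) * (p / 2 * Γ) := by field_simp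
        _ ≤ lam ^ 2 * (2 / p) * (γ 0 + 3 / p * (8 * (2 * D + 2 * SR)
        + (2 * ((lam * p) ^ 2 * (2 * G)) + 2 * ((lam * p) ^ 2 * (4 * D + 4 * SR))))) := by
          gcongr
          refine e3.trans_eq ?_
          ring
        _ ≤ _ := by gcongr
    refine h.trans_eq ?_
    field_simp
    ring
  -- Substituting both bounds, the right side contains `D` with coefficient at most (192 +
  -- 208·144)/10⁶, well below 3/4, so `D` is absorbed at the cost of a factor 4: 1664 = 4·208·2,
  -- 120576 = 4·(192 + 208·144), 32 = 4·8. The absorption of 144λ²/p² is what requires λ to be small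
  -- relative to p.
  have e5 : D ≤ 1664 * lam ^ 2 / p * γ 0 + 120576 * lam ^ 2 / p ^ 2 * SR + G / 2
      + 32 * lam ^ 2 / k ^ 2 * SQ := by
    have h1 : D ≤ 192 * lam ^ 2 * (SR + D + Γ) + 16 * lam ^ 2 * (Γ + G)
        + 8 * lam ^ 2 / k ^ 2 * SQ := by
      refine e1.trans ?_
      have : 8 * lam ^ 2 / k ^ 2 * SQ = 8 * (lam ^ 2 / k ^ 2 * SQ) := by ring
      nlinarith
    have h2 : lam ^ 2 * D ≤ 1 / 1000000 * D := by gcongr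
    have h3 : 144 * lam ^ 2 / p ^ 2 * D ≤ 144 / 1000000 * D := by
      refine mul_le_mul_of_nonneg_right ?_ hD0
      rw [div_le_div_iff₀ (by positivity) (by norm_num)]
      linarith
    have h4 : lam ^ 2 * SR ≤ lam ^ 2 / p ^ 2 * SR := by
      gcongr
      rw [le_div_iff₀ (by positivity)]
      exact mul_le_of_le_one_right (sq_nonneg lam) (pow_le_one₀ hp.le hp1)
    have h5 : lam ^ 2 * G ≤ 1 / 1000000 * G := by gcongr
    have h6 : lam ^ 4 * G ≤ 1 / 1000000 * G := by
      refine mul_le_mul_of_nonneg_right ?_ hG0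
      calc lam ^ 4 = lam ^ 2 * lam ^ 2 := by ring
        _ ≤ 1 * (1 / 1000000) := by gcongr; linarith
        _ = _ := by ring
    have h7 : 144 * lam ^ 2 / p ^ 2 * (SR + D)
      = 144 * (lam ^ 2 / p ^ 2 * SR) + 144 * lam ^ 2 / p ^ 2 * D := by ring
    have h8 : 120576 * lam ^ 2 / p ^ 2 * SR = 120576 * (lam ^ 2 / p ^ 2 * SR) := by ring
    have h9 : 1664 * lam ^ 2 / p * γ 0 = 832 * (2 * lam ^ 2 / p * γ 0) := by ring
    have h10 : 32 * lam ^ 2 / k ^ 2 * SQ = 4 * (8 * lam ^ 2 / k ^ 2 * SQ) := by ring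
    have h11 : 0 ≤ lam ^ 2 / p ^ 2 * SR := by positivity
    have h12 : 0 ≤ 2 * lam ^ 2 / p * γ 0 := mul_nonneg (by positivity) hγ0
    rw [h7] at e3'
    rw [h8, h9, h10]
    linarith
  have e6 : G / 2 ≤ (f 0 - fmin) / η - SI + D / 2 + 2 * L * η * SM := by
    have h : η * (G / 2) ≤ η * ((f 0 - fmin) / η - SI + D / 2 + 2 * L * η * SM) := by
      refine le_of_eq_of_le (by ring) (e4.trans_eq ?_)
      field_simp
    exact le_of_mul_le_mul_left h hη
  have h1 : 832 * lam ^ 2 / p * γ 0 = (1664 * lam ^ 2 / p * γ 0) / 2 := by ring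
  have h2 : 60288 * lam ^ 2 / p ^ 2 * SR = (120576 * lam ^ 2 / p ^ 2 * SR) / 2 := by ring
  have h3 : 16 * lam ^ 2 / k ^ 2 * SQ = (32 * lam ^ 2 / k ^ 2 * SQ) / 2 := by ring
  rw [h1, h2, h3]
  linarith

end Recursions

/-! ### The pathwise bound for a whole run. -/

section Run

variable {n d K : ℕ} {ηc L p : ℝ} {h : Fin n → Vec d → Vec d}
  {W : Matrix (Fin n) (Fin n) ℝ}

/-- The mean square of the accumulated noise over the local steps of a round. -/
noncomputable def roundNoiseSq (K : ℕ) (ηc : ℝ) (h : Fin n → Vec d → Vec d)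
    (g : ℕ → Fin n → Vec d → Vec d) (x c : Fin n → Vec d) : ℝ :=
  (n : ℝ)⁻¹ * ∑ i, (K : ℝ)⁻¹ * ∑ k ∈ Finset.range K, ‖roundNoise ηc h g x c k i‖ ^ 2

lemma mean_initCorrection (hn : 1 ≤ n) (G : Fin n → Vec d) : mean (initCorrection G) = 0 := by
  unfold initCorrection
  rw [mean_add, mean_const hn]
  simp [mean]

/-- Up to sign, the initial correction error is the centred family G_i - ∇f_i(x₀), and centring does
not increase the mean square. -/
lemma correctionError_initCorrection (hn : 1 ≤ n) (x₀ : Vec d) (G : Fin n → Vec d) :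
    meanSq (correctionError h (fun _ => x₀) (initCorrection G))
      ≤ meanSq (fun i => G i - h i x₀) := by
  refine le_trans (le_of_eq ?_) (meanSq_sub_mean_le hn (fun i => G i - h i x₀))
  unfold correctionError initCorrection meanSq
  congr 1
  refine Finset.sum_congr rfl fun i _ => ?_
  rw [← norm_neg, mean_sub, mean_const hn]
  congr 2
  module

/-- The pathwise bound for a run of K-GT with an arbitrary gradient oracle `g`. -/
theorem sum_sq_gradient_le (hW : IsMixing d p W) (hn : 1 ≤ n) (hK : 1 ≤ K) (hp : 0 < p)
    (hp1 : p ≤ 1) (hL : 0 < L) (hηc : 0 < ηc) (hηL : 1000 * (K * ηc * L) ≤ p)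
    (hLip : ∀ i x y, ‖h i x - h i y‖ ≤ L * ‖x - y‖) {f : Vec d → ℝ} {fmin : ℝ}
    (hf : ∀ x, HasGradientAt f (mean fun i => h i x) x) (hfmin : ∀ x, fmin ≤ f x)
    (g : ℕ → ℕ → Fin n → Vec d → Vec d) (x₀ : Vec d) (G : Fin n → Vec d)
    {x c : ℕ → Fin n → Vec d}
    (hx : ∀ t, x t = (iterates K ηc p W g x₀ (initCorrection G) t).1)
    (hc : ∀ t, c t = (iterates K ηc p W g x₀ (initCorrection G) t).2) (N : ℕ) :
    1 / 4 * ∑ t ∈ Finset.range N, ‖mean fun i => h i (mean (x t))‖ ^ 2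
      ≤ (f x₀ - fmin) / (K * p * ηc)
      - ∑ t ∈ Finset.range N, inner ℝ (mean fun i => h i (mean (x t)))
        (mean fun i => (K : ℝ)⁻¹ • roundNoise ηc h (g t) (x t) (c t) K i)
      + 832 * (K * ηc * L) ^ 2 / p * meanSq (fun i => G i - h i x₀)
      + 60288 * (K * ηc * L) ^ 2 / p ^ 2 * ∑ t ∈ Finset.range N,
        meanSq (fun i => (K : ℝ)⁻¹ • roundNoise ηc h (g t) (x t) (c t) K i)
      + 16 * (K * ηc * L) ^ 2 / K ^ 2 * ∑ t ∈ Finset.range N,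
        roundNoiseSq K ηc h (g t) (x t) (c t)
      + 2 * L * (K * p * ηc) * ∑ t ∈ Finset.range N,
        ‖mean fun i => (K : ℝ)⁻¹ • roundNoise ηc h (g t) (x t) (c t) K i‖ ^ 2 := by
  have hK0 : (0 : ℝ) < K := by positivity
  have hlam0 : 0 ≤ K * ηc * L := by positivity
  set u : ℕ → Fin n → Vec d := fun t i =>
    (K : ℝ)⁻¹ • ∑ j ∈ Finset.range K, g t j i (localSteps ηc (g t) (x t) (c t) j i) with hu
  have hz : ∀ t i, tracking K ηc (g t) (x t) (c t) i = u t i + c t i := fun t i =>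
    tracking_eq hK hηc.ne' _ _ _ _
  have hxs : ∀ t, x (t + 1)
      = gossip W fun j => x t j - ((K : ℝ) * p * ηc) • (u t j + c t j) := by
    intro t
    simp only [← hz]
    rw [hx (t + 1), hx t, hc t]; rfl
  have hcs : ∀ t i, c (t + 1) i
      = c t i - (u t i + c t i) + ∑ j, W i j • (u t j + c t j) := by
    intro t i
    simp only [← hz]
    rw [hc (t + 1), hx t, hc t]; rfl
  have hx0 : x 0 = fun _ => x₀ := by rw [hx]; rfl
  have hc0 : c 0 = initCorrection G := by rw [hc]; rfl
  have hcm : ∀ t, mean (c t) = 0 := by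
    intro t
    induction t with
    | zero => rw [hc0]; exact mean_initCorrection hn G
    | succ t ih =>
      exact (hW.correction_step hn hp hp1 hLip (x t) (c t) (u t) (x (t + 1)) ih _ (hcs t)).1
  have hum : ∀ t, mean (fun j => u t j + c t j) = mean (u t) := fun t => by
    rw [mean_add, hcm, add_zero]
  have hxm : ∀ t, mean (x (t + 1)) = mean (x t) - ((K : ℝ) * p * ηc) • mean (u t) := by
    intro t
    rw [hxs, (hW.consensus_step hn hp hp1 (x t) _ 0 _).1, hum]
  have hLipm : ∀ x y, ‖(mean fun i => h i x) - mean fun i => h i y‖ ≤ L * ‖x - y‖ := by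
    intro x y
    rw [← mean_sub]
    refine le_of_sq_le_sq ?_ (by positivity)
    refine (norm_mean_sq_le hn _).trans ?_
    have := meanSq_le_meanSq (v := fun i => h i x - h i y) (w := fun _ => L • (x - y))
      (fun i => (hLip i x y).trans_eq (by rw [norm_smul, Real.norm_of_nonneg hL.le]))
    rw [meanSq_const hn, norm_smul, Real.norm_of_nonneg hL.le] at this
    exact this
  have hdev : ∀ t, meanSq (fun i => u t i - h i (mean (x t)))
      ≤ 2 * (L ^ 2 * roundDrift K ηc (g t) (x t) (c t))
        + 2 * meanSq (fun i => (K : ℝ)⁻¹ • roundNoise ηc h (g t) (x t) (c t) K i) :=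
    fun t => meanSq_avg_oracle_sub_le hK hLip _ _ _
  have hrd : ∀ t, 0 ≤ roundDrift K ηc (g t) (x t) (c t) := fun t => by
    unfold roundDrift; positivity
  -- Squared distances are scaled by L² so that all quantities are comparable with squared
  -- gradients.
  have main := sum_sq_gradient_le_of_recursions (lam := K * ηc * L) (p := p) (L := L)
    (η := K * p * ηc) (k := K) (fmin := fmin) (f := fun t => f (mean (x t)))
    (a := fun t => L ^ 2 * meanSq (fun i => x t i - mean (x t)))
    (γ := fun t => meanSq (correctionError h (x t) (c t)))
    (δ := fun t => L ^ 2 * roundDrift K ηc (g t) (x t) (c t))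
    (g := fun t => ‖mean fun i => h i (mean (x t))‖ ^ 2)
    (R := fun t => meanSq (fun i => (K : ℝ)⁻¹ • roundNoise ηc h (g t) (x t) (c t) K i))
    (Q := fun t => roundNoiseSq K ηc h (g t) (x t) (c t))
    (M := fun t => ‖mean fun i => (K : ℝ)⁻¹ • roundNoise ηc h (g t) (x t) (c t) K i‖ ^ 2)
    (I := fun t => inner ℝ (mean fun i => h i (mean (x t)))
        (mean fun i => (K : ℝ)⁻¹ • roundNoise ηc h (g t) (x t) (c t) K i))
    hp hp1 hlam0 hηL (by positivity)
    (fun t => mul_nonneg (by positivity) (meanSq_nonneg _)) (fun t => meanSq_nonneg _)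
    (fun t => mul_nonneg (by positivity) (hrd t)) (fun t => by positivity)
    (fun t => meanSq_nonneg _)
    (by simp [hx0, mean_const hn, meanSq])
    (fun t => by
      have : 8 * (K * ηc * L) ^ 2 ≤ 1 := by nlinarith
      exact roundDrift_le hn hK this hLip (g t) (x t) (c t))
    (fun t => by
      -- Centring at ∇f(x̄) splits z_i - ∇f(x̄) into the oracle deviation at x̄ and the correction
      -- error.
      have h1 := (hW.consensus_step hn hp hp1 (x t) (fun j => u t j + c t j)
        (mean fun i => h i (mean (x t))) (K * p * ηc)).2
      rw [← hxs] at h1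
      have h2 := meanSq_add_le (fun i => u t i - h i (mean (x t)))
        (correctionError h (x t) (c t))
      have h3 : (fun i => u t i + c t i - mean fun i => h i (mean (x t)))
          = fun i => u t i - h i (mean (x t)) + correctionError h (x t) (c t) i := by
        ext1 i; unfold correctionError; abel
      rw [h3] at h1
      have h4 := hdev t
      calc _ ≤ L ^ 2 * ((1 - p / 2) * meanSq (fun i => x t i - mean (x t))
            + 3 * (K * p * ηc) ^ 2 / p * (2 * (2 * (L ^ 2 * roundDrift K ηc (g t) (x t) (c t))
        + 2 * meanSq (fun i => (K : ℝ)⁻¹ • roundNoise ηc h (g t) (x t) (c t) K i))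
          + 2 * meanSq (correctionError h (x t) (c t)))) := by
            gcongr
            refine h1.trans ?_
            gcongr
            linarith
        _ = _ := by ring)
    (fun t => by
      have h1 := (hW.correction_step hn hp hp1 hLip (x t) (c t) (u t) (x (t + 1))
        (hcm t) _ (hcs t)).2
      have h2 : L ^ 2 * ‖mean (x (t + 1)) - mean (x t)‖ ^ 2
          = (K * ηc * L * p) ^ 2 * ‖mean (u t)‖ ^ 2 := by
        rw [hxm, sub_sub_cancel_left, norm_neg, norm_smul, mul_pow, Real.norm_eq_abs, sq_abs]
        ring
      have h3 : ‖mean (u t)‖ ^ 2 ≤ 2 * ‖mean fun i => h i (mean (x t))‖ ^ 2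
          + 2 * meanSq (fun i => u t i - h i (mean (x t))) := by
        have a1 := norm_add_sq_le_young (mean fun i => h i (mean (x t)))
          (mean (fun i => u t i - h i (mean (x t)))) one_pos
        have a2 := norm_mean_sq_le hn (fun i => u t i - h i (mean (x t)))
        rw [mean_sub, add_sub_cancel] at a1
        rw [mean_sub] at a2
        linarith
      have h4 := hdev t
      rw [h2] at h1
      refine h1.trans ?_
      gcongr
      linarith)
    (fun t => by
      have h1 := descent_step hf hLipm hL.le (η := K * p * ηc) (by positivity)
        (by nlinarith) (mean (x t))
        (mean fun i => (K : ℝ)⁻¹ • ∑ j ∈ Finset.range K,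
          h i (localSteps ηc (g t) (x t) (c t) j i))
        (mean fun i => (K : ℝ)⁻¹ • roundNoise ηc h (g t) (x t) (c t) K i)
      rw [← mean_add] at h1
      simp only [← avg_oracle_eq] at h1
      rw [← hxm t] at h1
      have h2 := norm_mean_sq_le hn (fun i => (K : ℝ)⁻¹ • ∑ j ∈ Finset.range K,
          h i (localSteps ηc (g t) (x t) (c t) j i) - h i (mean (x t)))
      rw [mean_sub] at h2
      have h3 := h2.trans (meanSq_avg_gradient_sub_le (ηc := ηc) hK hLip (g t) (x t) (c t))
      refine h1.trans ?_
      gcongr)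
    (fun t => hfmin _) N
  have h0 := correctionError_initCorrection (h := h) hn x₀ G
  rw [← hc0, ← hx0] at h0
  simp only [hx0, mean_const hn] at main h0 ⊢
  refine main.trans ?_
  gcongr

end Run

/-! ### Second moments of random vectors. -/

section Expectations

variable {Ω : Type*} [MeasurableSpace Ω] {P : Measure Ω}

lemma integrable_inner_of_memLp {E : Type*} [NormedAddCommGroup E] [InnerProductSpace ℝ E]
    {u v : Ω → E} (hu : MemLp u 2 P) (hv : MemLp v 2 P) :
    Integrable (fun ω => inner ℝ (u ω) (v ω)) P := by
  refine Integrable.mono' (hu.norm.integrable_sq.add hv.norm.integrable_sq)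
    (hu.1.inner hv.1) (.of_forall fun ω => ?_)
  have := norm_inner_le_norm (𝕜 := ℝ) (u ω) (v ω)
  simp only [Pi.add_apply]
  nlinarith [sq_nonneg (‖u ω‖ - ‖v ω‖), sq_nonneg ‖u ω‖, sq_nonneg ‖v ω‖]

/-- The second moment of a sum of orthogonal square integrable random vectors. -/
lemma integral_norm_sum_sq_le {ι E : Type*} [NormedAddCommGroup E] [InnerProductSpace ℝ E]
    (s : Finset ι) (v : ι → Ω → E) {b : ℝ} (hv : ∀ i ∈ s, MemLp (v i) 2 P)
    (horth : ∀ i ∈ s, ∀ j ∈ s, i ≠ j → ∫ ω, inner ℝ (v i ω) (v j ω) ∂P = 0)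
    (hb : ∀ i ∈ s, ∫ ω, ‖v i ω‖ ^ 2 ∂P ≤ b) :
    ∫ ω, ‖∑ i ∈ s, v i ω‖ ^ 2 ∂P ≤ s.card * b := by
  have hint : ∀ i ∈ s, ∀ j ∈ s, Integrable (fun ω => inner ℝ (v i ω) (v j ω)) P :=
    fun i hi j hj => integrable_inner_of_memLp (hv i hi) (hv j hj)
  calc ∫ ω, ‖∑ i ∈ s, v i ω‖ ^ 2 ∂P
      = ∫ ω, ∑ i ∈ s, ∑ j ∈ s, inner ℝ (v i ω) (v j ω) ∂P := by
        congr 1; ext ω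
        rw [← real_inner_self_eq_norm_sq, sum_inner]
        simp only [inner_sum]
    _ = ∑ i ∈ s, ∑ j ∈ s, ∫ ω, inner ℝ (v i ω) (v j ω) ∂P := by
        rw [integral_finsetSum _ fun i hi => integrable_finsetSum _ fun j hj => hint i hi j hj]
        exact Finset.sum_congr rfl fun i hi => integral_finsetSum _ fun j hj => hint i hi j hj
    _ = ∑ i ∈ s, ∫ ω, ‖v i ω‖ ^ 2 ∂P := by
        refine Finset.sum_congr rfl fun i hi => ?_
        rw [Finset.sum_eq_single i (fun j hj hji => horth i hi j hj hji.symm)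
          (fun h => absurd hi h)]
        simp only [real_inner_self_eq_norm_sq]
    _ ≤ s.card * b := by
        rw [← nsmul_eq_mul]
        exact Finset.sum_le_card_nsmul _ _ _ hb

lemma continuous_of_norm_sub_le {d : ℕ} {L : ℝ} {h : Vec d → Vec d}
    (hLip : ∀ x y, ‖h x - h y‖ ≤ L * ‖x - y‖) : Continuous h :=
  (LipschitzWith.of_dist_le' (K := L) fun x y => by
    rw [dist_eq_norm, dist_eq_norm]; exact hLip x y).continuous

lemma memLp_of_lipschitz [IsFiniteMeasure P] {d : ℕ} {L : ℝ} {h : Vec d → Vec d}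
    (hLip : ∀ x y, ‖h x - h y‖ ≤ L * ‖x - y‖) {X : Ω → Vec d} (hX : MemLp X 2 P) :
    MemLp (fun ω => h (X ω)) 2 P := by
  have hc : Continuous h := continuous_of_norm_sub_le hLip
  have hbound : MemLp (fun ω => ‖h 0‖ + L * ‖X ω‖) 2 P :=
    MemLp.add (f := fun _ => ‖h 0‖) (memLp_const _) (hX.norm.const_mul L)
  have hm : AEStronglyMeasurable (fun ω => h (X ω)) P := hc.comp_aestronglyMeasurable hX.1
  refine hbound.mono' hm (.of_forall fun ω => ?_)
  have h1 := hLip (X ω) 0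
  rw [sub_zero] at h1
  have h2 := norm_sub_norm_le (h (X ω)) (h 0)
  linarith

end Expectations

/-! ### Gradient noise and independence of the samples. -/

section Oracle

variable {n d : ℕ} {Ξ Ω : Type*} [MeasurableSpace Ξ] {m mΩ : MeasurableSpace Ω} {P : Measure Ω}
  {L σ : ℝ} {D : Fin n → Measure Ξ} {F : Fin n → Vec d → Ξ → ℝ}

lemma IsProblem.continuous_gradient (hP : IsProblem L σ D F) (i : Fin n) :
    Continuous (gradient (localLoss D F i)) :=
  continuous_of_norm_sub_le (hP.smooth i)

lemma IsProblem.hasGradientAt_globalLoss (hP : IsProblem L σ D F) (x : Vec d) :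
    HasGradientAt (globalLoss D F) (mean fun i => gradient (localLoss D F i) x) x := by
  rw [hasGradientAt_iff_hasFDerivAt]
  have h1 : HasFDerivAt (fun y => ∑ i, localLoss D F i y)
      (∑ i, InnerProductSpace.toDual ℝ _ (gradient (localLoss D F i) x)) x :=
    HasFDerivAt.fun_sum fun i _ => (hP.differentiable i x).hasGradientAt.hasFDerivAt
  have h2 := h1.const_mul ((n : ℝ)⁻¹)
  have e : InnerProductSpace.toDual ℝ (Vec d) (mean fun i => gradient (localLoss D F i) x)
      = (n : ℝ)⁻¹ • ∑ i, InnerProductSpace.toDual ℝ _ (gradient (localLoss D F i) x) := by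
    simp [mean, map_sum]
  rw [e]
  exact h2

lemma integrable_sq_norm_of_lintegral_le {E : Type*} [NormedAddCommGroup E] {X : Ω → E} {b : ℝ}
    (hX : AEStronglyMeasurable X P) (h : ∫⁻ ω, ‖X ω‖ₑ ^ 2 ∂P ≤ ENNReal.ofReal b) (hb : 0 ≤ b) :
    MemLp X 2 P ∧ ∫ ω, ‖X ω‖ ^ 2 ∂P ≤ b := by
  have he : ∀ ω, ENNReal.ofReal (‖X ω‖ ^ 2) = ‖X ω‖ₑ ^ 2 := fun ω => by
    rw [ENNReal.ofReal_pow (norm_nonneg _), ofReal_norm]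
  have hint : Integrable (fun ω => ‖X ω‖ ^ 2) P := by
    refine ⟨hX.norm.pow 2, ?_⟩
    rw [hasFiniteIntegral_iff_ofReal (.of_forall fun ω => by positivity)]
    simp only [he]
    exact h.trans_lt ENNReal.ofReal_lt_top
  refine ⟨(memLp_two_iff_integrable_sq_norm hX).2 hint, ?_⟩
  rw [integral_eq_lintegral_of_nonneg_ae (.of_forall fun ω => by positivity) hint.1]
  simp only [he]
  exact ENNReal.toReal_le_of_le_ofReal hb h

/-- The noise of the stochastic gradient of client `i`. -/
@[irreducible]
noncomputable def gradNoise (D : Fin n → Measure Ξ) (F : Fin n → Vec d → Ξ → ℝ) (i : Fin n)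
    (x : Vec d) (s : Ξ) : Vec d :=
  stochGrad F i x s - gradient (localLoss D F i) x

lemma IsProblem.measurable_gradNoise (hP : IsProblem L σ D F) (i : Fin n) :
    Measurable fun q : Vec d × Ξ => gradNoise D F i q.1 q.2 := by
  unfold gradNoise
  exact (hP.measurable_stochGrad i).sub ((hP.continuous_gradient i).measurable.comp measurable_fst)

lemma IsProblem.variance_gradNoise (hP : IsProblem L σ D F) (i : Fin n) (x : Vec d) :
    ∫⁻ s, ‖gradNoise D F i x s‖ₑ ^ 2 ∂(D i) ≤ ENNReal.ofReal (σ ^ 2) := by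
  unfold gradNoise
  exact hP.variance i x

/-- Integrability is a consequence of the variance bound on a probability space; it then passes to
the stochastic gradient, which differs by a constant, and the integral can be split. -/
lemma IsProblem.integral_gradNoise (hP : IsProblem L σ D F) (i : Fin n) (x : Vec d) :
    Integrable (gradNoise D F i x) (D i) ∧ ∫ s, gradNoise D F i x s ∂(D i) = 0 := by
  have := hP.prob i
  have hmeas : Measurable (gradNoise D F i x) :=
    (hP.measurable_gradNoise i).comp measurable_prodMk_left
  have hi : Integrable (gradNoise D F i x) (D i) :=
    (integrable_sq_norm_of_lintegral_le hmeas.aestronglyMeasurable (hP.variance_gradNoise i x)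
      (sq_nonneg σ)).1.integrable (by norm_num)
  refine ⟨hi, ?_⟩
  have hi' : Integrable (fun s => stochGrad F i x s) (D i) := by
    have h := hi.add (integrable_const (gradient (localLoss D F i) x))
    refine h.congr (.of_forall fun s => ?_)
    simp [gradNoise]
  unfold gradNoise
  rw [integral_sub hi' (integrable_const _), hP.unbiased]
  simp

/-- A kernel with variance at most `b`, evaluated at a random point that is independent of the
sample, has variance at most `b`. -/
lemma memLp_of_indep [IsProbabilityMeasure P] {μ : Measure Ξ} [IsProbabilityMeasure μ]
    {α : Type*} [MeasurableSpace α] {N : α → Ξ → Vec d}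
    (hN : Measurable fun q : α × Ξ => N q.1 q.2) {b : ℝ} (hb : 0 ≤ b)
    (hvar : ∀ x, ∫⁻ s, ‖N x s‖ₑ ^ 2 ∂μ ≤ ENNReal.ofReal b)
    {X : Ω → α} (hX : Measurable X) {ζ : Ω → Ξ} (hζ : Measurable ζ)
    (law : P.map ζ = μ) (hind : IndepFun X ζ P) :
    MemLp (fun ω => N (X ω) (ζ ω)) 2 P ∧ ∫ ω, ‖N (X ω) (ζ ω)‖ ^ 2 ∂P ≤ b := by
  have hmap := (indepFun_iff_map_prod_eq_prod_map_map hX.aemeasurable hζ.aemeasurable).1 hind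
  rw [law] at hmap
  refine integrable_sq_norm_of_lintegral_le (hN.comp (hX.prodMk hζ)).aestronglyMeasurable ?_ hb
  have : IsProbabilityMeasure (P.map X) := Measure.isProbabilityMeasure_map hX.aemeasurable
  calc _ = ∫⁻ q, ‖N q.1 q.2‖ₑ ^ 2 ∂(P.map fun ω => (X ω, ζ ω)) :=
        (lintegral_map (hN.enorm.pow_const 2) (hX.prodMk hζ)).symm
    _ = ∫⁻ x, ∫⁻ s, ‖N x s‖ₑ ^ 2 ∂μ ∂(P.map X) := by
        rw [hmap, lintegral_prod _ (hN.enorm.pow_const 2).aemeasurable]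
    _ ≤ ∫⁻ _, ENNReal.ofReal b ∂(P.map X) := lintegral_mono fun x => hvar x
    _ = ENNReal.ofReal b := by simp

/-- A centred kernel, evaluated at an independent sample, has mean zero. -/
lemma integral_eq_zero_of_indep [IsProbabilityMeasure P] {μ : Measure Ξ} [IsProbabilityMeasure μ]
    {α : Type*} [MeasurableSpace α] {φ : α → Ξ → ℝ}
    (hφ : Measurable fun q : α × Ξ => φ q.1 q.2) (h0 : ∀ x, ∫ s, φ x s ∂μ = 0)
    {X : Ω → α} (hX : Measurable X) {ζ : Ω → Ξ} (hζ : Measurable ζ)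
    (law : P.map ζ = μ) (hind : IndepFun X ζ P)
    (hint : Integrable (fun ω => φ (X ω) (ζ ω)) P) :
    ∫ ω, φ (X ω) (ζ ω) ∂P = 0 := by
  have hmap := (indepFun_iff_map_prod_eq_prod_map_map hX.aemeasurable hζ.aemeasurable).1 hind
  rw [law] at hmap
  have : IsProbabilityMeasure (P.map X) := Measure.isProbabilityMeasure_map hX.aemeasurable
  have hφint : Integrable (fun q : α × Ξ => φ q.1 q.2) ((P.map X).prod μ) := by
    rw [← hmap, integrable_map_measure hφ.aestronglyMeasurable (hX.prodMk hζ).aemeasurable]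
    exact hint
  have h1 : ∫ ω, φ (X ω) (ζ ω) ∂P = ∫ q, φ q.1 q.2 ∂(P.map fun ω => (X ω, ζ ω)) :=
    (integral_map (hX.prodMk hζ).aemeasurable hφ.aestronglyMeasurable).symm
  rw [h1, hmap, integral_prod _ hφint]
  simp [h0]

/-- A stochastic gradient evaluated at a random point that is independent of the sample has
variance at most `σ²`. -/
lemma IsProblem.memLp_gradNoise [IsProbabilityMeasure P] (hP : IsProblem L σ D F) (i : Fin n)
    (hm : m ≤ mΩ) {X : Ω → Vec d} (hX : Measurable[m] X) {ζ : Ω → Ξ} (hζ : Measurable ζ)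
    (law : P.map ζ = D i) (hind : Indep m (MeasurableSpace.comap ζ inferInstance) P) :
    MemLp (fun ω => gradNoise D F i (X ω) (ζ ω)) 2 P ∧
    ∫ ω, ‖gradNoise D F i (X ω) (ζ ω)‖ ^ 2 ∂P ≤ σ ^ 2 := by
  have := hP.prob i
  have hXζ : IndepFun X ζ P := (IndepFun_iff_Indep _ _ _).2
    (indep_of_indep_of_le_left hind hX.comap_le)
  exact memLp_of_indep (hP.measurable_gradNoise i) (sq_nonneg σ) (hP.variance_gradNoise i)
    (hX.mono hm le_rfl) hζ law hXζ

/-- The noise of a fresh sample is orthogonal to everything independent of the sample. -/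
lemma IsProblem.integral_inner_gradNoise [IsProbabilityMeasure P] (hP : IsProblem L σ D F)
    (i : Fin n) (hm : m ≤ mΩ) {X Y : Ω → Vec d} (hX : Measurable[m] X)
    (hY : Measurable[m] Y) (hY2 : MemLp Y 2 P) {ζ : Ω → Ξ} (hζ : Measurable ζ)
    (law : P.map ζ = D i) (hind : Indep m (MeasurableSpace.comap ζ inferInstance) P) :
    ∫ ω, inner ℝ (Y ω) (gradNoise D F i (X ω) (ζ ω)) ∂P = 0 := by
  have := hP.prob i
  -- Point and test vector are frozen together, so Fubini leaves an inner integral over the sample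
  -- alone.
  have hXY : Measurable[m] fun ω => (X ω, Y ω) := hX.prodMk hY
  have hXζ : IndepFun (fun ω => (X ω, Y ω)) ζ P := (IndepFun_iff_Indep _ _ _).2
    (indep_of_indep_of_le_left hind hXY.comap_le)
  refine integral_eq_zero_of_indep (α := Vec d × Vec d) (X := fun ω => (X ω, Y ω))
    (φ := fun q s => inner ℝ q.2 (gradNoise D F i q.1 s)) ?_ ?_ (hXY.mono hm le_rfl) hζ law hXζ
    (integrable_inner_of_memLp hY2 (hP.memLp_gradNoise i hm hX hζ law hind).1)
  · have h1 : Measurable fun q : (Vec d × Vec d) × Ξ => (q.1.1, q.2) := by fun_prop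
    have h2 : Measurable fun q : (Vec d × Vec d) × Ξ => q.1.2 := by fun_prop
    exact h2.inner ((hP.measurable_gradNoise i).comp h1)
  · intro q
    rw [integral_inner (hP.integral_gradNoise i q.1).1, (hP.integral_gradNoise i q.1).2,
      inner_zero_right]

variable {ξinit : Fin n → Ω → Ξ} {ξ : ℕ → ℕ → Fin n → Ω → Ξ}

/-- The family of all samples. -/
def allSamples (ξinit : Fin n → Ω → Ξ) (ξ : ℕ → ℕ → Fin n → Ω → Ξ) :
    Fin n ⊕ (ℕ × ℕ × Fin n) → Ω → Ξ :=
  Sum.elim ξinit (fun j : ℕ × ℕ × Fin n => ξ j.1 j.2.1 j.2.2)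

/-- The information in all samples but one. -/
@[reducible]
def samplesExcept (ξinit : Fin n → Ω → Ξ) (ξ : ℕ → ℕ → Fin n → Ω → Ξ)
    (s : Fin n ⊕ (ℕ × ℕ × Fin n)) : MeasurableSpace Ω :=
  ⨆ r ∈ ({s}ᶜ : Set (Fin n ⊕ (ℕ × ℕ × Fin n))),
    MeasurableSpace.comap (allSamples ξinit ξ r) inferInstance

lemma IsSampling.measurable_allSamples (hS : IsSampling P D ξinit ξ)
    (r : Fin n ⊕ (ℕ × ℕ × Fin n)) : Measurable (allSamples ξinit ξ r) := by
  rcases r with i | ⟨t, k, i⟩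
  · exact hS.measurable_init i
  · exact hS.measurable_step t k i

lemma IsSampling.samplesExcept_le (hS : IsSampling P D ξinit ξ)
    (s : Fin n ⊕ (ℕ × ℕ × Fin n)) : samplesExcept ξinit ξ s ≤ mΩ :=
  iSup₂_le fun r _ => (hS.measurable_allSamples r).comap_le

lemma measurable_samplesExcept {s r : Fin n ⊕ (ℕ × ℕ × Fin n)} (hrs : r ≠ s) :
    Measurable[samplesExcept ξinit ξ s] (allSamples ξinit ξ r) :=
  measurable_iff_comap_le.2 (le_iSup₂_of_le r hrs le_rfl)

/-- Conditioning on all other samples, rather than on the past, also covers two clients sampling in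
the same local step. -/
lemma IsSampling.indep_samplesExcept (hS : IsSampling P D ξinit ξ)
    (s : Fin n ⊕ (ℕ × ℕ × Fin n)) :
    Indep (samplesExcept ξinit ξ s)
      (MeasurableSpace.comap (allSamples ξinit ξ s) inferInstance) P := by
  have h := indep_iSup_of_disjoint (fun r => (hS.measurable_allSamples r).comap_le)
    ((iIndepFun_iff_iIndep _ _ _).1 hS.indep)
    (S := {s}ᶜ) (T := {s}) (by simp [disjoint_compl_left])
  simpa [samplesExcept] using h

end Oracle

/-! ### Measurability and integrability of client means. -/

section MeasurabilityOfMeans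

variable {n d : ℕ} {Ω : Type*}

lemma measurable_smul_fun {m : MeasurableSpace Ω} {X : Ω → Vec d} (hX : Measurable[m] X) (a : ℝ) :
    Measurable[m] fun ω => a • X ω :=
  Measurable.const_smul hX a

lemma measurable_mean {m : MeasurableSpace Ω} {X : Ω → Fin n → Vec d}
    (hX : ∀ i, Measurable[m] fun ω => X ω i) : Measurable[m] fun ω => mean (X ω) :=
  measurable_smul_fun (Finset.measurable_sum _ fun j _ => hX j) _

variable [MeasurableSpace Ω] {P : Measure Ω}

lemma memLp_smul_fun {X : Ω → Vec d} (hX : MemLp X 2 P) (a : ℝ) :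
    MemLp (fun ω => a • X ω) 2 P :=
  MemLp.const_smul hX a

lemma memLp_mean {X : Ω → Fin n → Vec d} (hX : ∀ i, MemLp (fun ω => X ω i) 2 P) :
    MemLp (fun ω => mean (X ω)) 2 P :=
  memLp_smul_fun (memLp_finsetSum _ fun j _ => hX j) _

end MeasurabilityOfMeans

/-! ### Random runs: freshness of samples, moments and orthogonality of the noise. -/

/-- The data of a random run of K-GT with initial local gradients `G`. -/
structure Run (n d : ℕ) (Ξ Ω : Type*) where
  K : ℕ
  ηc : ℝ
  ηs : ℝ
  W : Matrix (Fin n) (Fin n) ℝ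
  F : Fin n → Vec d → Ξ → ℝ
  ξinit : Fin n → Ω → Ξ
  ξ : ℕ → ℕ → Fin n → Ω → Ξ
  x₀ : Vec d
  G : Ω → Fin n → Vec d

namespace Run

variable {n d : ℕ} {Ξ Ω : Type*} (r : Run n d Ξ Ω)

/-- The stochastic gradient oracle of the run. -/
noncomputable def oracle (ω : Ω) (t k : ℕ) (i : Fin n) (x : Vec d) : Vec d :=
  stochGrad r.F i x (r.ξ t k i ω)

/-- Models of round `t`. -/
noncomputable def x (t : ℕ) (ω : Ω) : Fin n → Vec d :=
  (iterates r.K r.ηc r.ηs r.W (r.oracle ω) r.x₀ (initCorrection (r.G ω)) t).1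

/-- Corrections of round `t`. -/
noncomputable def c (t : ℕ) (ω : Ω) : Fin n → Vec d :=
  (iterates r.K r.ηc r.ηs r.W (r.oracle ω) r.x₀ (initCorrection (r.G ω)) t).2

/-- Local models after `k` local steps of round `t`. -/
noncomputable def y (t k : ℕ) (ω : Ω) : Fin n → Vec d :=
  localSteps r.ηc (r.oracle ω t) (r.x t ω) (r.c t ω) k

lemma x_succ (t : ℕ) (ω : Ω) (i : Fin n) : r.x (t + 1) ω i = ∑ j, r.W i j •
    (r.x t ω j - ((r.K : ℝ) * r.ηs * r.ηc) • ((r.K : ℝ) * r.ηc)⁻¹ •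
      (r.x t ω j - r.y t r.K ω j)) := rfl

lemma c_succ (t : ℕ) (ω : Ω) (i : Fin n) : r.c (t + 1) ω i =
    r.c t ω i - ((r.K : ℝ) * r.ηc)⁻¹ • (r.x t ω i - r.y t r.K ω i)
      + ∑ j, r.W i j • ((r.K : ℝ) * r.ηc)⁻¹ • (r.x t ω j - r.y t r.K ω j) := rfl

lemma y_succ (t k : ℕ) (ω : Ω) (i : Fin n) : r.y t (k + 1) ω i =
    r.y t k ω i - r.ηc • (stochGrad r.F i (r.y t k ω i) (r.ξ t k i ω) + r.c t ω i) := rfl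

variable [MeasurableSpace Ξ] {L σ : ℝ} {D : Fin n → Measure Ξ}

section Measurability

variable {m : MeasurableSpace Ω}

/-- The model after k steps has used only samples j < k; the strict inequality makes sample k fresh
there. -/
lemma measurable_y_of (hP : IsProblem L σ D r.F) {t : ℕ}
    (hx : ∀ i, Measurable[m] fun ω => r.x t ω i) (hc : ∀ i, Measurable[m] fun ω => r.c t ω i)
    {k : ℕ} (hξ : ∀ j < k, ∀ i, Measurable[m] (r.ξ t j i)) (i : Fin n) :
    Measurable[m] fun ω => r.y t k ω i := by
  induction k with
  | zero => exact hx i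
  | succ k ih =>
    have h1 := ih fun j hj => hξ j (by omega)
    have h2 : Measurable[m] fun ω => stochGrad r.F i (r.y t k ω i) (r.ξ t k i ω) :=
      (hP.measurable_stochGrad i).comp (h1.prodMk (hξ k (by omega) i))
    simp only [y_succ]
    exact h1.sub (measurable_smul_fun (h2.add (hc i)) _)

lemma measurable_x_c (hP : IsProblem L σ D r.F) (hG : ∀ i, Measurable[m] fun ω => r.G ω i)
    {t : ℕ} (hξ : ∀ t' < t, ∀ j i, Measurable[m] (r.ξ t' j i)) :
    (∀ i, Measurable[m] fun ω => r.x t ω i) ∧ ∀ i, Measurable[m] fun ω => r.c t ω i := by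
  induction t with
  | zero =>
    refine ⟨fun i => measurable_const, fun i => ?_⟩
    exact (hG i).neg.add (measurable_mean hG)
  | succ t ih =>
    obtain ⟨hx, hc⟩ := ih fun t' ht' => hξ t' (by omega)
    have hy := fun i => r.measurable_y_of hP hx hc (k := r.K)
      (fun j _ i => hξ t (by omega) j i) i
    have hz : ∀ i, Measurable[m]
        fun ω => ((r.K : ℝ) * r.ηc)⁻¹ • (r.x t ω i - r.y t r.K ω i) :=
      fun i => measurable_smul_fun ((hx i).sub (hy i)) _
    simp only [x_succ, c_succ]
    refine ⟨fun i => Finset.measurable_sum _ fun j _ =>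
      measurable_smul_fun ((hx j).sub (measurable_smul_fun (hz j) _)) _, fun i => ?_⟩
    exact ((hc i).sub (hz i)).add (Finset.measurable_sum _ fun j _ => measurable_smul_fun (hz j) _)

end Measurability

variable {mΩ : MeasurableSpace Ω} {P : Measure Ω}

/-- The gradient noise of client `i` in local step `k` of round `t`. -/
noncomputable def noise (D : Fin n → Measure Ξ) (t k : ℕ) (i : Fin n) (ω : Ω) : Vec d :=
  gradNoise D r.F i (r.y t k ω i) (r.ξ t k i ω)

/-- The initial gradients are determined by the initial samples. -/
def InitMeasurable : Prop :=
  ∀ m : MeasurableSpace Ω, (∀ i, Measurable[m] (r.ξinit i)) → ∀ i, Measurable[m] fun ω => r.G ω i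

variable {r}

lemma measurable_step_samplesExcept {s : Fin n ⊕ (ℕ × ℕ × Fin n)} {t k : ℕ} {i : Fin n}
    (h : Sum.inr (t, k, i) ≠ s) : Measurable[samplesExcept r.ξinit r.ξ s] (r.ξ t k i) :=
  measurable_samplesExcept h

lemma measurable_G_samplesExcept (hG : r.InitMeasurable) (q : ℕ × ℕ × Fin n) (i : Fin n) :
    Measurable[samplesExcept r.ξinit r.ξ (Sum.inr q)] fun ω => r.G ω i :=
  hG _ (fun i => measurable_samplesExcept (r := Sum.inl i) (by simp)) i

lemma measurable_x_c_samplesExcept (hP : IsProblem L σ D r.F) (hG : r.InitMeasurable)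
    {t : ℕ} {q : ℕ × ℕ × Fin n} (hq : t ≤ q.1) :
    (∀ i, Measurable[samplesExcept r.ξinit r.ξ (Sum.inr q)] fun ω => r.x t ω i) ∧
    ∀ i, Measurable[samplesExcept r.ξinit r.ξ (Sum.inr q)] fun ω => r.c t ω i := by
  refine r.measurable_x_c hP (measurable_G_samplesExcept hG q) fun t' ht' j i =>
    measurable_step_samplesExcept ?_
  rintro h
  obtain rfl := Sum.inr_injective h
  simp at hq; omega

lemma measurable_y_samplesExcept (hP : IsProblem L σ D r.F) (hG : r.InitMeasurable)
    {t k k' : ℕ} (hk : k ≤ k') (i i' : Fin n) :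
    Measurable[samplesExcept r.ξinit r.ξ (Sum.inr (t, k', i'))] fun ω => r.y t k ω i := by
  obtain ⟨hx, hc⟩ := measurable_x_c_samplesExcept (t := t) (q := (t, k', i')) hP hG le_rfl
  refine r.measurable_y_of hP hx hc (fun j hj i => measurable_step_samplesExcept ?_) i
  simp; omega

/-- Of two distinct noises in a round, the one that is not later does not see the sample of the
other; for k = k' this holds because the clients differ. This gives orthogonality in
`integral_inner_noise_noise`. -/
lemma measurable_noise_samplesExcept (hP : IsProblem L σ D r.F) (hG : r.InitMeasurable)
    {t k k' : ℕ} (hk : k ≤ k') {i i' : Fin n} (hne : (k, i) ≠ (k', i')) :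
    Measurable[samplesExcept r.ξinit r.ξ (Sum.inr (t, k', i'))] (r.noise D t k i) := by
  refine (hP.measurable_gradNoise i).comp
    ((measurable_y_samplesExcept hP hG hk i i').prodMk (measurable_step_samplesExcept ?_))
  intro h
  apply hne
  simp at h
  simp [h]

variable [IsProbabilityMeasure P]

lemma memLp_noise (hP : IsProblem L σ D r.F) (hG : r.InitMeasurable)
    (hS : IsSampling P D r.ξinit r.ξ) (t k : ℕ) (i : Fin n) :
    MemLp (r.noise D t k i) 2 P ∧ ∫ ω, ‖r.noise D t k i ω‖ ^ 2 ∂P ≤ σ ^ 2 :=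
  hP.memLp_gradNoise i (hS.samplesExcept_le (Sum.inr (t, k, i)))
    (measurable_y_samplesExcept hP hG le_rfl i i) (hS.measurable_step t k i) (hS.law_step t k i)
    (hS.indep_samplesExcept (Sum.inr (t, k, i)))

lemma integral_inner_noise (hP : IsProblem L σ D r.F) (hG : r.InitMeasurable)
    (hS : IsSampling P D r.ξinit r.ξ) {t k : ℕ} {i : Fin n} {Y : Ω → Vec d}
    (hY : Measurable[samplesExcept r.ξinit r.ξ (Sum.inr (t, k, i))] Y) (hY2 : MemLp Y 2 P) :
    ∫ ω, inner ℝ (Y ω) (r.noise D t k i ω) ∂P = 0 :=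
  hP.integral_inner_gradNoise i (hS.samplesExcept_le (Sum.inr (t, k, i)))
    (measurable_y_samplesExcept hP hG le_rfl i i) hY hY2 (hS.measurable_step t k i)
    (hS.law_step t k i) (hS.indep_samplesExcept (Sum.inr (t, k, i)))

lemma integral_inner_noise_noise (hP : IsProblem L σ D r.F) (hG : r.InitMeasurable)
    (hS : IsSampling P D r.ξinit r.ξ) (t : ℕ) {q q' : ℕ × Fin n} (hne : q ≠ q') :
    ∫ ω, inner ℝ (r.noise D t q.1 q.2 ω) (r.noise D t q'.1 q'.2 ω) ∂P = 0 := by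
  rcases le_total q.1 q'.1 with h | h
  · exact integral_inner_noise hP hG hS (measurable_noise_samplesExcept hP hG h hne)
      (memLp_noise hP hG hS _ _ _).1
  · simp only [real_inner_comm (r.noise D t q'.1 q'.2 _)]
    exact integral_inner_noise hP hG hS (measurable_noise_samplesExcept hP hG h hne.symm)
      (memLp_noise hP hG hS _ _ _).1

/-- A stochastic gradient is noise of bounded variance plus a Lipschitz image of the model, so
square integrability propagates step by step. -/
lemma memLp_y_of (hP : IsProblem L σ D r.F) (hG : r.InitMeasurable)
    (hS : IsSampling P D r.ξinit r.ξ) {t : ℕ} (hx : ∀ i, MemLp (fun ω => r.x t ω i) 2 P)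
    (hc : ∀ i, MemLp (fun ω => r.c t ω i) 2 P) (k : ℕ) (i : Fin n) :
    MemLp (fun ω => r.y t k ω i) 2 P := by
  induction k with
  | zero => exact hx i
  | succ k ih =>
    have e : (fun ω => r.y t (k + 1) ω i) = fun ω => r.y t k ω i - r.ηc •
        (r.noise D t k i ω + gradient (localLoss D r.F i) (r.y t k ω i) + r.c t ω i) := by
      ext1 ω
      rw [y_succ, noise, gradNoise, sub_add_cancel]
    rw [e]
    exact ih.sub ((((memLp_noise hP hG hS t k i).1.add
      (memLp_of_lipschitz (hP.smooth i) ih)).add (hc i)).const_smul r.ηc)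

lemma memLp_x_c (hP : IsProblem L σ D r.F) (hG : r.InitMeasurable)
    (hS : IsSampling P D r.ξinit r.ξ) (hG2 : ∀ i, MemLp (fun ω => r.G ω i) 2 P) (t : ℕ) :
    (∀ i, MemLp (fun ω => r.x t ω i) 2 P) ∧ ∀ i, MemLp (fun ω => r.c t ω i) 2 P := by
  induction t with
  | zero =>
    refine ⟨fun i => memLp_const r.x₀, fun i => ?_⟩
    exact (hG2 i).neg.add (memLp_mean hG2)
  | succ t ih =>
    obtain ⟨hx, hc⟩ := ih
    have hy := fun i => memLp_y_of hP hG hS hx hc r.K i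
    have hz : ∀ i, MemLp
        (fun ω => ((r.K : ℝ) * r.ηc)⁻¹ • (r.x t ω i - r.y t r.K ω i)) 2 P :=
      fun i => memLp_smul_fun ((hx i).sub (hy i)) _
    simp only [x_succ, c_succ]
    refine ⟨fun i => memLp_finsetSum _ fun j _ =>
      memLp_smul_fun ((hx j).sub (memLp_smul_fun (hz j) _)) _, fun i => ?_⟩
    exact ((hc i).sub (hz i)).add (memLp_finsetSum _ fun j _ => memLp_smul_fun (hz j) _)

/-- The gradient of the objective at the averaged model. -/
noncomputable def grad (r : Run n d Ξ Ω) (D : Fin n → Measure Ξ) (t : ℕ) (ω : Ω) : Vec d :=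
  mean fun i => gradient (localLoss D r.F i) (mean (r.x t ω))

lemma memLp_grad (hP : IsProblem L σ D r.F) (hG : r.InitMeasurable)
    (hS : IsSampling P D r.ξinit r.ξ) (hG2 : ∀ i, MemLp (fun ω => r.G ω i) 2 P) (t : ℕ) :
    MemLp (r.grad D t) 2 P := by
  have hx := (memLp_x_c hP hG hS hG2 t).1
  have hm : MemLp (fun ω => mean (r.x t ω)) 2 P :=
    memLp_mean hx
  exact memLp_mean fun j => memLp_of_lipschitz (hP.smooth j) hm

lemma measurable_grad (hP : IsProblem L σ D r.F) (hG : r.InitMeasurable)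
    (t k : ℕ) (i : Fin n) :
    Measurable[samplesExcept r.ξinit r.ξ (Sum.inr (t, k, i))] (r.grad D t) := by
  have hx := (measurable_x_c_samplesExcept (t := t) (q := (t, k, i)) hP hG le_rfl).1
  have hm : Measurable[samplesExcept r.ξinit r.ξ (Sum.inr (t, k, i))]
      fun ω => mean (r.x t ω) :=
    measurable_mean hx
  exact measurable_mean fun j => (hP.continuous_gradient j).measurable.comp hm

/-- The accumulated noise of the first `k` local steps of round `t`. -/
noncomputable def noiseSum (r : Run n d Ξ Ω) (D : Fin n → Measure Ξ) (t k : ℕ) (i : Fin n)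
    (ω : Ω) : Vec d :=
  ∑ j ∈ Finset.range k, r.noise D t j i ω

lemma roundNoise_eq (t k : ℕ) (i : Fin n) (ω : Ω) :
    roundNoise r.ηc (fun i => gradient (localLoss D r.F i)) (r.oracle ω t) (r.x t ω) (r.c t ω) k i
      = r.noiseSum D t k i ω := by
  unfold noiseSum noise gradNoise
  rfl

lemma memLp_noiseSum (hP : IsProblem L σ D r.F) (hG : r.InitMeasurable)
    (hS : IsSampling P D r.ξinit r.ξ) (t k : ℕ) (i : Fin n) :
    MemLp (r.noiseSum D t k i) 2 P :=
  memLp_finsetSum _ fun j _ => (memLp_noise hP hG hS t j i).1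

lemma integral_noiseSum_sq_le (hP : IsProblem L σ D r.F) (hG : r.InitMeasurable)
    (hS : IsSampling P D r.ξinit r.ξ) (t k : ℕ) (i : Fin n) :
    ∫ ω, ‖r.noiseSum D t k i ω‖ ^ 2 ∂P ≤ k * σ ^ 2 := by
  have := integral_norm_sum_sq_le (P := P) (Finset.range k) (fun j => r.noise D t j i)
    (fun j _ => (memLp_noise hP hG hS t j i).1)
    (fun j _ j' _ hne => integral_inner_noise_noise hP hG hS t (q := (j, i)) (q' := (j', i))
      (by simpa using hne))
    (fun j _ => (memLp_noise hP hG hS t j i).2)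
  simpa [noiseSum] using this

/-- The noise of the averaged model in round `t`. -/
noncomputable def meanNoise (r : Run n d Ξ Ω) (D : Fin n → Measure Ξ) (t : ℕ) (ω : Ω) : Vec d :=
  mean fun i => (r.K : ℝ)⁻¹ • r.noiseSum D t r.K i ω

/-- Flattened to one sum of nK pairwise orthogonal terms, the mean noise has variance σ²/(nK), the
source of the speedup in n. -/
lemma meanNoise_eq (t : ℕ) (ω : Ω) : r.meanNoise D t ω = ((n : ℝ) * r.K)⁻¹ •
    ∑ q ∈ Finset.range r.K ×ˢ Finset.univ, r.noise D t q.1 q.2 ω := by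
  rw [Finset.sum_product_right, meanNoise, mean, ← Finset.smul_sum, smul_smul, mul_inv]
  rfl

lemma memLp_meanNoise (hP : IsProblem L σ D r.F) (hG : r.InitMeasurable)
    (hS : IsSampling P D r.ξinit r.ξ) (t : ℕ) : MemLp (r.meanNoise D t) 2 P :=
  memLp_mean fun i => memLp_smul_fun (memLp_noiseSum hP hG hS t r.K i) _

lemma integral_meanNoise_sq_le (hP : IsProblem L σ D r.F) (hG : r.InitMeasurable)
    (hS : IsSampling P D r.ξinit r.ξ) (hn : 1 ≤ n) (hK : 1 ≤ r.K) (t : ℕ) :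
    ∫ ω, ‖r.meanNoise D t ω‖ ^ 2 ∂P ≤ σ ^ 2 / (n * r.K) := by
  have h := integral_norm_sum_sq_le (P := P) (Finset.range r.K ×ˢ Finset.univ)
    (fun q : ℕ × Fin n => r.noise D t q.1 q.2)
    (fun q _ => (memLp_noise hP hG hS t _ _).1)
    (fun q _ q' _ hne => integral_inner_noise_noise hP hG hS t hne)
    (fun q _ => (memLp_noise hP hG hS t _ _).2)
  have hK0 : (0 : ℝ) < r.K := by positivity
  have hn0 : (0 : ℝ) < n := by positivity
  simp only [meanNoise_eq, norm_smul, mul_pow, integral_const_mul, Real.norm_eq_abs, sq_abs]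
  calc _ ≤ (((n : ℝ) * r.K)⁻¹) ^ 2 * _ := mul_le_mul_of_nonneg_left h (by positivity)
    _ = _ := by
      rw [Finset.card_product]
      simp
      field_simp

/-- ∇f(x̄) at the start of round t involves no sample of round t. -/
lemma integral_inner_grad_meanNoise (hP : IsProblem L σ D r.F) (hG : r.InitMeasurable)
    (hS : IsSampling P D r.ξinit r.ξ) (hG2 : ∀ i, MemLp (fun ω => r.G ω i) 2 P) (t : ℕ) :
    ∫ ω, inner ℝ (r.grad D t ω) (r.meanNoise D t ω) ∂P = 0 := by
  simp only [meanNoise_eq, real_inner_smul_right, integral_const_mul, inner_sum]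
  rw [integral_finsetSum _ fun q _ => integrable_inner_of_memLp (memLp_grad hP hG hS hG2 t)
    (memLp_noise hP hG hS t _ _).1]
  rw [Finset.sum_eq_zero fun q _ => integral_inner_noise hP hG hS (measurable_grad hP hG t _ _)
    (memLp_grad hP hG hS hG2 t)]
  simp

end Run

/-! ### Expectation of the pathwise bound. -/

lemma integrable_meanSq {n d : ℕ} {Ω : Type*} [MeasurableSpace Ω] {P : Measure Ω}
    {v : Ω → Fin n → Vec d} (hv : ∀ i, MemLp (fun ω => v ω i) 2 P) :
    Integrable (fun ω => meanSq (v ω)) P := by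
  unfold meanSq
  exact (integrable_finsetSum _ fun i _ => (hv i).norm.integrable_sq).const_mul _

lemma integral_meanSq_le {n d : ℕ} (hn : 1 ≤ n) {Ω : Type*} [MeasurableSpace Ω] {P : Measure Ω}
    {v : Ω → Fin n → Vec d} {b : ℝ} (hv : ∀ i, MemLp (fun ω => v ω i) 2 P)
    (hb : ∀ i, ∫ ω, ‖v ω i‖ ^ 2 ∂P ≤ b) :
    ∫ ω, meanSq (v ω) ∂P ≤ b := by
  unfold meanSq
  rw [integral_const_mul, integral_finsetSum _ fun i _ => (hv i).norm.integrable_sq]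
  have h := Finset.sum_le_card_nsmul Finset.univ _ b fun i _ => hb i
  have hn0 : (0 : ℝ) < n := by positivity
  calc _ ≤ (n : ℝ)⁻¹ * _ := mul_le_mul_of_nonneg_left h (by positivity)
    _ = b := by simp; field_simp

namespace Run

variable {n d : ℕ} {Ξ Ω : Type*} {r : Run n d Ξ Ω} [MeasurableSpace Ξ] {L σ p : ℝ}
  {D : Fin n → Measure Ξ} {mΩ : MeasurableSpace Ω} {P : Measure Ω} [IsProbabilityMeasure P]

/-- The second moment of the stochastic gradients along a run with `η_s = p`, in terms of the
initialization error `b` of the corrections. -/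
theorem sum_integral_sq_grad_le (hP : IsProblem L σ D r.F) (hG : r.InitMeasurable)
    (hS : IsSampling P D r.ξinit r.ξ) (hG2 : ∀ i, MemLp (fun ω => r.G ω i) 2 P)
    (hW : IsMixing d p r.W) (hn : 1 ≤ n) (hK : 1 ≤ r.K) (hp : 0 < p) (hp1 : p ≤ 1) (hL : 0 < L)
    (hηc : 0 < r.ηc) (hηs : r.ηs = p) (hηL : 1000 * (r.K * r.ηc * L) ≤ p) {b : ℝ}
    (hb : ∀ i, ∫ ω, ‖r.G ω i - gradient (localLoss D r.F i) r.x₀‖ ^ 2 ∂P ≤ b) (N : ℕ) :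
    1 / 4 * ∑ t ∈ Finset.range N, ∫ ω, ‖r.grad D t ω‖ ^ 2 ∂P
      ≤ initialGap D r.F r.x₀ / (r.K * p * r.ηc) + 832 * (r.K * r.ηc * L) ^ 2 / p * b
      + N * (60304 * (r.K * r.ηc * L) ^ 2 * σ ^ 2 / (p ^ 2 * r.K)
        + 2 * (r.K * r.ηc * L) * p * σ ^ 2 / (n * r.K)) := by
  have hK0 : (0 : ℝ) < r.K := by positivity
  have hn0 : (0 : ℝ) < n := by positivity
  have path : ∀ ω, 1 / 4 * ∑ t ∈ Finset.range N, ‖r.grad D t ω‖ ^ 2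
      ≤ initialGap D r.F r.x₀ / (r.K * p * r.ηc)
      - ∑ t ∈ Finset.range N, inner ℝ (r.grad D t ω) (r.meanNoise D t ω)
      + 832 * (r.K * r.ηc * L) ^ 2 / p *
        meanSq (fun i => r.G ω i - gradient (localLoss D r.F i) r.x₀)
      + 60288 * (r.K * r.ηc * L) ^ 2 / p ^ 2 * ∑ t ∈ Finset.range N,
        meanSq (fun i => (r.K : ℝ)⁻¹ • r.noiseSum D t r.K i ω)
      + 16 * (r.K * r.ηc * L) ^ 2 / r.K ^ 2 * ∑ t ∈ Finset.range N,
        (r.K : ℝ)⁻¹ * ∑ k ∈ Finset.range r.K, meanSq (fun i => r.noiseSum D t k i ω)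
      + 2 * L * (r.K * p * r.ηc) * ∑ t ∈ Finset.range N, ‖r.meanNoise D t ω‖ ^ 2 := by
    intro ω
    have h := sum_sq_gradient_le (h := fun i => gradient (localLoss D r.F i)) hW hn hK hp hp1 hL
      hηc hηL hP.smooth hP.hasGradientAt_globalLoss (fun x => ciInf_le hP.bddBelow x)
      (r.oracle ω) r.x₀ (r.G ω) (x := fun t => r.x t ω) (c := fun t => r.c t ω)
      (fun t => by rw [← hηs]; rfl) (fun t => by rw [← hηs]; rfl) N
    simp only [roundNoise_eq, roundNoiseSq] at h
    refine h.trans_eq ?_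
    have e : ∀ t, (n : ℝ)⁻¹ * ∑ i, (r.K : ℝ)⁻¹ *
        ∑ k ∈ Finset.range r.K, ‖r.noiseSum D t k i ω‖ ^ 2
        = (r.K : ℝ)⁻¹ * ∑ k ∈ Finset.range r.K, meanSq (fun i => r.noiseSum D t k i ω) := by
      intro t
      simp only [meanSq, ← Finset.mul_sum]
      rw [Finset.sum_comm]; ring
    simp only [e]
    rfl
  have hg := memLp_grad hP hG hS hG2
  have hM := memLp_meanNoise hP hG hS
  have hI : ∀ t, Integrable (fun ω => inner ℝ (r.grad D t ω) (r.meanNoise D t ω)) P :=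
    fun t => integrable_inner_of_memLp (hg t) (hM t)
  have hG2' : ∀ i, MemLp (fun ω => r.G ω i - gradient (localLoss D r.F i) r.x₀) 2 P :=
    fun i => (hG2 i).sub (memLp_const _)
  have hN : ∀ t k i, MemLp (fun ω => r.noiseSum D t k i ω) 2 P := memLp_noiseSum hP hG hS
  have hN' : ∀ t i, MemLp (fun ω => (r.K : ℝ)⁻¹ • r.noiseSum D t r.K i ω) 2 P :=
    fun t i => memLp_smul_fun (hN t r.K i) _
  have i0 : Integrable (fun _ : Ω => initialGap D r.F r.x₀ / (r.K * p * r.ηc)) P :=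
    integrable_const _
  have i1 : Integrable (fun ω => ∑ t ∈ Finset.range N,
      inner ℝ (r.grad D t ω) (r.meanNoise D t ω)) P := integrable_finsetSum _ fun t _ => hI t
  have i2 : Integrable (fun ω => 832 * (r.K * r.ηc * L) ^ 2 / p *
        meanSq (fun i => r.G ω i - gradient (localLoss D r.F i) r.x₀)) P :=
    (integrable_meanSq hG2').const_mul _
  have i3 : Integrable (fun ω => 60288 * (r.K * r.ηc * L) ^ 2 / p ^ 2 * ∑ t ∈ Finset.range N,
        meanSq (fun i => (r.K : ℝ)⁻¹ • r.noiseSum D t r.K i ω)) P :=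
    (integrable_finsetSum _ fun t _ => integrable_meanSq (hN' t)).const_mul _
  have i4' : ∀ t, Integrable (fun ω =>
      (r.K : ℝ)⁻¹ * ∑ k ∈ Finset.range r.K, meanSq (fun i => r.noiseSum D t k i ω)) P :=
    fun t => (integrable_finsetSum _ fun k _ => integrable_meanSq (hN t k)).const_mul _
  have i4 : Integrable (fun ω => 16 * (r.K * r.ηc * L) ^ 2 / r.K ^ 2 * ∑ t ∈ Finset.range N,
      (r.K : ℝ)⁻¹ * ∑ k ∈ Finset.range r.K, meanSq (fun i => r.noiseSum D t k i ω)) P :=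
    (integrable_finsetSum _ fun t _ => i4' t).const_mul _
  have i5 : Integrable (fun ω => 2 * L * (r.K * p * r.ηc) *
      ∑ t ∈ Finset.range N, ‖r.meanNoise D t ω‖ ^ 2) P :=
    (integrable_finsetSum _ fun t _ => (hM t).norm.integrable_sq).const_mul _
  have igr : Integrable (fun ω => 1 / 4 * ∑ t ∈ Finset.range N, ‖r.grad D t ω‖ ^ 2) P :=
    (integrable_finsetSum _ fun t _ => (hg t).norm.integrable_sq).const_mul _
  have main := integral_mono igr (((((i0.sub i1).add i2).add i3).add i4).add i5) path
  rw [integral_add' ((((i0.sub i1).add i2).add i3).add i4) i5,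
    integral_add' (((i0.sub i1).add i2).add i3) i4, integral_add' ((i0.sub i1).add i2) i3,
    integral_add' (i0.sub i1) i2, integral_sub' i0 i1] at main
  simp only [integral_const_mul] at main
  rw [integral_finsetSum _ fun t _ => (hg t).norm.integrable_sq,
    integral_finsetSum _ fun t _ => hI t,
    integral_finsetSum _ fun t _ => integrable_meanSq (hN' t),
    integral_finsetSum _ fun t _ => i4' t,
    integral_finsetSum _ fun t _ => (hM t).norm.integrable_sq,
    Finset.sum_eq_zero fun t _ => integral_inner_grad_meanNoise hP hG hS hG2 t] at main
  simp only [integral_const, probReal_univ, one_smul, sub_zero] at main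
  have b2 : ∫ ω, meanSq (fun i => r.G ω i - gradient (localLoss D r.F i) r.x₀) ∂P ≤ b :=
    integral_meanSq_le hn hG2' hb
  have b3 : ∑ t ∈ Finset.range N,
      ∫ ω, meanSq (fun i => (r.K : ℝ)⁻¹ • r.noiseSum D t r.K i ω) ∂P
      ≤ N * (σ ^ 2 / r.K) := by
    refine (Finset.sum_le_card_nsmul _ _ (σ ^ 2 / r.K) fun t _ => ?_).trans_eq (by simp)
    refine integral_meanSq_le hn (hN' t) fun i => ?_
    simp only [norm_smul, mul_pow, integral_const_mul, Real.norm_eq_abs, sq_abs]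
    calc _ ≤ ((r.K : ℝ)⁻¹) ^ 2 * _ :=
          mul_le_mul_of_nonneg_left (integral_noiseSum_sq_le hP hG hS t r.K i) (by positivity)
      _ = _ := by field_simp
  have b4 : ∑ t ∈ Finset.range N, ∫ ω,
      (r.K : ℝ)⁻¹ * ∑ k ∈ Finset.range r.K, meanSq (fun i => r.noiseSum D t k i ω) ∂P
      ≤ N * (r.K * σ ^ 2) := by
    refine (Finset.sum_le_card_nsmul _ _ (r.K * σ ^ 2) fun t _ => ?_).trans_eq (by simp)
    rw [integral_const_mul, integral_finsetSum _ fun k _ => integrable_meanSq (hN t k)]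
    have h := Finset.sum_le_card_nsmul (Finset.range r.K)
      (fun k => ∫ ω, meanSq (fun i => r.noiseSum D t k i ω) ∂P) (r.K * σ ^ 2) fun k hk => by
        refine integral_meanSq_le hn (hN t k) fun i =>
          (integral_noiseSum_sq_le hP hG hS t k i).trans ?_
        have : k ≤ r.K := (Finset.mem_range.1 hk).le
        gcongr
    calc _ ≤ (r.K : ℝ)⁻¹ * _ := mul_le_mul_of_nonneg_left h (by positivity)
      _ = _ := by simp; field_simp
  have b5 : ∑ t ∈ Finset.range N, ∫ ω, ‖r.meanNoise D t ω‖ ^ 2 ∂P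
      ≤ N * (σ ^ 2 / (n * r.K)) :=
    (Finset.sum_le_card_nsmul _ _ _ fun t _ =>
      integral_meanNoise_sq_le hP hG hS hn hK t).trans_eq (by simp)
  refine main.trans ?_
  -- Weakened by 1/p² ≥ 1 so that it merges with the 60288 term into 60304.
  have hp2 : 16 * (r.K * r.ηc * L) ^ 2 * σ ^ 2 / r.K
      ≤ 16 * (r.K * r.ηc * L) ^ 2 * σ ^ 2 / (p ^ 2 * r.K) := by
    gcongr
    exact mul_le_of_le_one_left hK0.le (pow_le_one₀ hp.le hp1)
  calc _ ≤ initialGap D r.F r.x₀ / (r.K * p * r.ηc) + 832 * (r.K * r.ηc * L) ^ 2 / p * b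
      + 60288 * (r.K * r.ηc * L) ^ 2 / p ^ 2 * (N * (σ ^ 2 / r.K))
      + 16 * (r.K * r.ηc * L) ^ 2 / r.K ^ 2 * (N * (r.K * σ ^ 2))
      + 2 * L * (r.K * p * r.ηc) * (N * (σ ^ 2 / (n * r.K))) := by gcongr
    _ = initialGap D r.F r.x₀ / (r.K * p * r.ηc) + 832 * (r.K * r.ηc * L) ^ 2 / p * b
      + N * (60288 * (r.K * r.ηc * L) ^ 2 * σ ^ 2 / (p ^ 2 * r.K)
        + 16 * (r.K * r.ηc * L) ^ 2 * σ ^ 2 / r.K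
        + 2 * (r.K * r.ηc * L) * p * σ ^ 2 / (n * r.K)) := by
        field_simp
        ring
    _ ≤ initialGap D r.F r.x₀ / (r.K * p * r.ηc) + 832 * (r.K * r.ηc * L) ^ 2 / p * b
      + N * (60288 * (r.K * r.ηc * L) ^ 2 * σ ^ 2 / (p ^ 2 * r.K)
        + 16 * (r.K * r.ηc * L) ^ 2 * σ ^ 2 / (p ^ 2 * r.K)
        + 2 * (r.K * r.ηc * L) * p * σ ^ 2 / (n * r.K)) := by gcongr
    _ = _ := by ring

end Run

/-! ### Choice of the stepsize. -/

section Stepsizes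

/-- The inverse, up to a constant, of the stepsize `K L η_c`. -/
noncomputable def invStep (n K : ℕ) (σ p ε : ℝ) : ℝ :=
  1 / p + σ / (p * √(K * ε)) + p * σ ^ 2 / (n * K * ε)

variable {n K : ℕ} {L σ p ε : ℝ}

lemma invStep_pos (hσ : 0 ≤ σ) (hp : 0 < p) (hε : 0 < ε) : 0 < invStep n K σ p ε := by
  unfold invStep; positivity

lemma one_le_mul_invStep (hσ : 0 ≤ σ) (hp : 0 < p) (hε : 0 < ε) :
    1 ≤ p * invStep n K σ p ε := by
  have h : 1 / p ≤ invStep n K σ p ε := by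
    unfold invStep
    rw [add_assoc]
    exact le_add_of_nonneg_right (by positivity)
  rwa [div_le_iff₀' hp] at h

lemma sq_div_le_invStep_sq (hK : 1 ≤ K) (hσ : 0 ≤ σ) (hp : 0 < p) (hε : 0 < ε) :
    σ ^ 2 / (p ^ 2 * K) ≤ ε * invStep n K σ p ε ^ 2 := by
  have hK0 : (0 : ℝ) < K := by positivity
  have h : σ / (p * √(K * ε)) ≤ invStep n K σ p ε := by
    unfold invStep
    have h1 : 0 ≤ 1 / p := by positivity
    have h2 : 0 ≤ p * σ ^ 2 / (n * K * ε) := by positivity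
    linarith
  calc σ ^ 2 / (p ^ 2 * K) = ε * (σ / (p * √(K * ε))) ^ 2 := by
        rw [div_pow, mul_pow, Real.sq_sqrt (by positivity)]
        field_simp
    _ ≤ _ := by gcongr

lemma mul_sq_div_le_invStep (hn : 1 ≤ n) (hK : 1 ≤ K) (hσ : 0 ≤ σ) (hp : 0 < p) (hε : 0 < ε) :
    p * σ ^ 2 / (n * K) ≤ ε * invStep n K σ p ε := by
  have hK0 : (0 : ℝ) < K := by positivity
  have hn0 : (0 : ℝ) < n := by positivity
  have h : p * σ ^ 2 / (n * K * ε) ≤ invStep n K σ p ε := by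
    unfold invStep
    exact le_add_of_nonneg_left (by positivity)
  calc p * σ ^ 2 / (n * K) = ε * (p * σ ^ 2 / (n * K * ε)) := by field_simp
    _ ≤ _ := by gcongr

/-- Links the three terms of the round bound to those of `invStep`: for the chosen η_c, the descent
term F₀/(K p η_c) is exactly 1000 ε times the round bound. -/
lemma mul_roundBound (hn : 1 ≤ n) (hK : 1 ≤ K) (hp : 0 < p) (hε : 0 < ε) (F₀ : ℝ) :
    ε * roundBound n K L σ p ε F₀ = invStep n K σ p ε / p * L * F₀ := by
  have hK0 : (0 : ℝ) < K := by positivity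
  have hn0 : (0 : ℝ) < n := by positivity
  have hsK : (0 : ℝ) < √(K : ℝ) := Real.sqrt_pos.2 hK0
  have hsε : 0 < √ε := Real.sqrt_pos.2 hε
  have h : ε ^ (3 / 2 : ℝ) = ε * √ε := by
    rw [Real.sqrt_eq_rpow, ← Real.rpow_one_add' hε.le (by norm_num)]
    norm_num
  unfold roundBound invStep
  rw [h, Real.sqrt_mul hK0.le]
  field_simp
  ring

end Stepsizes

/-! ### Conclusion for a run and for both initializations. -/

namespace Run

variable {n d : ℕ} {Ξ Ω : Type*} {r : Run n d Ξ Ω} [MeasurableSpace Ξ] {L σ p ε : ℝ}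
  {D : Fin n → Measure Ξ} {mΩ : MeasurableSpace Ω} {P : Measure Ω} [IsProbabilityMeasure P]

/-- Both initializations at once: `b` is their only difference, and `hTb` asks that its contribution
be averaged out over the rounds. -/
theorem avgSqGradLE (hP : IsProblem L σ D r.F) (hG : r.InitMeasurable)
    (hS : IsSampling P D r.ξinit r.ξ) (hG2 : ∀ i, MemLp (fun ω => r.G ω i) 2 P)
    (hW : IsMixing d p r.W) (hn : 1 ≤ n) (hK : 1 ≤ r.K) (hp : 0 < p) (hp1 : p ≤ 1) (hL : 0 < L)
    (hσ : 0 ≤ σ) (hε : 0 < ε)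
    (hηc : r.ηc = 1 / (1000 * invStep n r.K σ p ε) / (r.K * L)) (hηs : r.ηs = p) {b : ℝ}
    (hb : ∀ i, ∫ ω, ‖r.G ω i - gradient (localLoss D r.F i) r.x₀‖ ^ 2 ∂P ≤ b) {T : ℕ}
    (hT : 16000 * roundBound n r.K L σ p ε (initialGap D r.F r.x₀) ≤ (T : ℝ) + 1)
    (hTb : b / (p * invStep n r.K σ p ε ^ 2) ≤ ε * ((T : ℝ) + 1)) :
    AvgSqGradLE P D r.F
      (averagedModel r.K r.ηc r.ηs r.W r.F r.ξ r.x₀ r.G) T ε := by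
  have hK0 : (0 : ℝ) < r.K := by positivity
  have hn0 : (0 : ℝ) < n := by positivity
  set A := invStep n r.K σ p ε with hA
  have hA0 : 0 < A := invStep_pos hσ hp hε
  have hgrad : ∀ t ω, gradient (globalLoss D r.F)
      (averagedModel r.K r.ηc r.ηs r.W r.F r.ξ r.x₀ r.G t ω) = r.grad D t ω :=
    fun t ω => (hP.hasGradientAt_globalLoss _).gradient
  unfold AvgSqGradLE
  simp only [hgrad]
  refine ⟨fun t _ => (memLp_grad hP hG hS hG2 t).norm.integrable_sq, ?_⟩
  have hlam : r.K * r.ηc * L = 1 / (1000 * A) := by rw [hηc]; field_simp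
  have hηc0 : 0 < r.ηc := by rw [hηc]; positivity
  have hstep : 1000 * (r.K * r.ηc * L) ≤ p := by
    rw [hlam]
    have : 1000 * (1 / (1000 * A)) = 1 / A := by field_simp
    rw [this, div_le_iff₀ hA0]
    exact one_le_mul_invStep hσ hp hε
  have h := sum_integral_sq_grad_le hP hG hS hG2 hW hn hK hp hp1 hL hηc0 hηs hstep hb (T + 1)
  have hT0 : (0 : ℝ) < (T : ℝ) + 1 := by positivity
  have t1 : initialGap D r.F r.x₀ / (r.K * p * r.ηc) ≤ ε * ((T : ℝ) + 1) / 16 := by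
    have e : initialGap D r.F r.x₀ / (r.K * p * r.ηc)
        = 1000 * (ε * roundBound n r.K L σ p ε (initialGap D r.F r.x₀)) := by
      rw [mul_roundBound hn hK hp hε, ← hA, hηc]
      field_simp
    rw [e]
    nlinarith
  have t2 : 832 * (r.K * r.ηc * L) ^ 2 / p * b ≤ ε * ((T : ℝ) + 1) / 16 := by
    have e : 832 * (r.K * r.ηc * L) ^ 2 / p * b = 832 / 1000000 * (b / (p * A ^ 2)) := by
      rw [hlam]; field_simp; ring
    rw [e]
    nlinarith
  have t3 : 60304 * (r.K * r.ηc * L) ^ 2 * σ ^ 2 / (p ^ 2 * r.K) ≤ 61 / 1000 * ε := by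
    have e : 60304 * (r.K * r.ηc * L) ^ 2 * σ ^ 2 / (p ^ 2 * r.K)
        = 60304 / 1000000 * ((σ ^ 2 / (p ^ 2 * r.K)) / A ^ 2) := by
      rw [hlam]; field_simp; ring
    have h1 : (σ ^ 2 / (p ^ 2 * r.K)) / A ^ 2 ≤ ε := by
      rw [div_le_iff₀ (by positivity)]
      exact sq_div_le_invStep_sq hK hσ hp hε
    rw [e]
    linarith
  have t4 : 2 * (r.K * r.ηc * L) * p * σ ^ 2 / (n * r.K) ≤ 2 / 1000 * ε := by
    have e : 2 * (r.K * r.ηc * L) * p * σ ^ 2 / (n * r.K)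
        = 2 / 1000 * ((p * σ ^ 2 / (n * r.K)) / A) := by
      rw [hlam]; field_simp
    have h1 : (p * σ ^ 2 / (n * r.K)) / A ≤ ε := by
      rw [div_le_iff₀ hA0]
      exact mul_sq_div_le_invStep hn hK hσ hp hε
    rw [e]
    linarith
  push_cast at h
  have h5 : ((T : ℝ) + 1) * (60304 * (r.K * r.ηc * L) ^ 2 * σ ^ 2 / (p ^ 2 * r.K)
      + 2 * (r.K * r.ηc * L) * p * σ ^ 2 / (n * r.K)) ≤ ((T : ℝ) + 1) * (63 / 1000 * ε) := by
    gcongr; linarith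
  rw [one_div, inv_mul_le_iff₀ hT0]
  -- The left side carries a factor 1/4, and 1/16 + 1/16 + 63/1000 < 1/4.
  nlinarith [mul_pos hT0 hε]

end Run

end KGT

theorem theorem1 :
    ∃ C : ℝ, 0 < C ∧
      ∀ (n K : ℕ) (L σ p ε : ℝ), 1 ≤ n → 1 ≤ K → 0 < L → 0 ≤ σ → 0 < p → p ≤ 1 → 0 < ε →
      -- constant stepsizes
      ∃ ηc ηs : ℝ, 0 < ηc ∧ ηc ≤ C * (p / (K * L)) ∧ 0 < ηs ∧ ηs ≤ C * p ∧
      ∀ (d : ℕ) (W : Matrix (Fin n) (Fin n) ℝ), KGT.IsMixing d p W →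
      ∀ (Ξ : Type*) [MeasurableSpace Ξ] (D : Fin n → MeasureTheory.Measure Ξ)
        (F : Fin n → KGT.Vec d → Ξ → ℝ), KGT.IsProblem L σ D F →
      ∀ (Ω : Type*) [MeasurableSpace Ω] (P : MeasureTheory.Measure Ω)
        [MeasureTheory.IsProbabilityMeasure P]
        (ξinit : Fin n → Ω → Ξ) (ξ : ℕ → ℕ → Fin n → Ω → Ξ), KGT.IsSampling P D ξinit ξ →
      ∀ x₀ : KGT.Vec d,
        -- corrections initialized with the local gradients `∇fᵢ(x₀)`
        (∀ T : ℕ,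
          C * KGT.roundBound n K L σ p ε (KGT.initialGap D F x₀) ≤ (T : ℝ) + 1 →
          KGT.AvgSqGradLE P D F
            (KGT.averagedModel K ηc ηs W F ξ x₀
              (fun _ i => gradient (KGT.localLoss D F i) x₀)) T ε) ∧
        -- corrections initialized with the stochastic gradients `∇Fᵢ(x₀; ξinit i)`
        (∀ T : ℕ,
          C * (KGT.roundBound n K L σ p ε (KGT.initialGap D F x₀)
            + p * min (K : ℝ) (σ ^ 2 / ε)) ≤ (T : ℝ) + 1 →
          KGT.AvgSqGradLE P D F
            (KGT.averagedModel K ηc ηs W F ξ x₀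
              (fun ω i => KGT.stochGrad F i x₀ (ξinit i ω))) T ε) := by
  -- 16000 = 16 · 1000: the descent term is 1000 ε times the round bound and may use 1/16 of ε(T +
  -- 1).
  refine ⟨16000, by norm_num, ?_⟩
  intro n K L σ p ε hn hK hL hσ hp hp1 hε
  have hK0 : (0 : ℝ) < K := by positivity
  have hA0 : 0 < KGT.invStep n K σ p ε := KGT.invStep_pos hσ hp hε
  have hA1 : 1 ≤ p * KGT.invStep n K σ p ε := KGT.one_le_mul_invStep hσ hp hε
  have hA2 := KGT.sq_div_le_invStep_sq (n := n) hK hσ hp hε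
  refine ⟨1 / (1000 * KGT.invStep n K σ p ε) / (K * L), p, by positivity, ?_, hp, by linarith, ?_⟩
  · rw [← mul_div_assoc]
    gcongr
    rw [div_le_iff₀ (by positivity)]
    linarith
  intro d W hW Ξ _ D F hP Ω _ P _ ξinit ξ hS x₀
  have hgap : 0 ≤ KGT.initialGap D F x₀ := sub_nonneg.2 (ciInf_le hP.bddBelow x₀)
  constructor
  · intro T hT
    refine KGT.Run.avgSqGradLE (r := ⟨K, _, p, W, F, ξinit, ξ, x₀,
      fun _ i => gradient (KGT.localLoss D F i) x₀⟩) (b := 0) hP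
      (fun m _ i => measurable_const) hS (fun i => memLp_const _) hW hn hK hp hp1 hL hσ hε rfl rfl
      (fun i => by simp) hT ?_
    rw [zero_div]; positivity
  · intro T hT
    have hB : 0 ≤ KGT.roundBound n K L σ p ε (KGT.initialGap D F x₀) := by
      unfold KGT.roundBound; positivity
    have hmin : 0 ≤ p * min (K : ℝ) (σ ^ 2 / ε) := by positivity
    -- The starting point is deterministic, so the trivial σ-algebra serves as the past.
    have hnoise : ∀ i, MemLp (fun ω => KGT.gradNoise D F i x₀ (ξinit i ω)) 2 P ∧
        ∫ ω, ‖KGT.gradNoise D F i x₀ (ξinit i ω)‖ ^ 2 ∂P ≤ σ ^ 2 := fun i =>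
      hP.memLp_gradNoise i bot_le (X := fun _ => x₀) measurable_const (hS.measurable_init i)
        (hS.law_init i) (indep_bot_left _)
    refine KGT.Run.avgSqGradLE (r := ⟨K, _, p, W, F, ξinit, ξ, x₀,
      fun ω i => KGT.stochGrad F i x₀ (ξinit i ω)⟩) (b := σ ^ 2) hP
      (fun m hm i => ?_) hS (fun i => ?_) hW hn hK hp hp1 hL hσ hε rfl rfl
      (fun i => ?_) (by linarith) ?_
    · exact (hP.measurable_stochGrad i).comp (measurable_const.prodMk (hm i))
    · have h := (hnoise i).1.add (memLp_const (gradient (KGT.localLoss D F i) x₀))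
      refine h.ae_eq (.of_forall fun ω => ?_)
      simp [KGT.gradNoise]
    · have h := (hnoise i).2
      unfold KGT.gradNoise at h
      exact h
    · have h1 : σ ^ 2 / (p * KGT.invStep n K σ p ε ^ 2) ≤ ε * (p * min (K : ℝ) (σ ^ 2 / ε)) := by
        rcases min_choice (K : ℝ) (σ ^ 2 / ε) with h | h <;> rw [h]
        · rw [div_le_iff₀ (by positivity)] at hA2 ⊢
          linarith
        · have e : ε * (p * (σ ^ 2 / ε)) = p * σ ^ 2 := by field_simp
          rw [e, div_le_iff₀ (by positivity)]
          nlinarith [mul_nonneg (sq_nonneg σ) (sub_nonneg.2 (one_le_pow₀ hA1 (n := 2)))]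
      have h2 : p * min (K : ℝ) (σ ^ 2 / ε) ≤ (T : ℝ) + 1 := by linarith
      exact h1.trans (by gcongr)
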